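/- Let $\mathbb{F}$ be an algebraically closed field. Conventions. A rational matrix $R(\lambda)$ over $\mathbb{F}(\lambda)$ is *regular at* $\lambda_0\in\mathbb{F}$ if it is square, defined (finite) at $\lambda_0$ and $\det R(\lambda_0)\ne 0$; it is *regular at* $\infty$ if $R(1/\lambda)$ is regular at $0$. Two matrices $G,H\in\mathbb{F}(\lambda)^{p\times m}$ are *equivalent at* a point of $\mathbb{F}\cup\{\infty\}$ if $H=R_1GR_2$ with $R_1,R_2$ regular at that point. If $G$ has normal rank $r$, its *invariant orders at* $\lambda_0\in\mathbb{F}$ (respectively *at infinity*) are the uniquely determined integers $\nu_1\le\cdots\le\nu_r$ such that $G$ is equivalent at $\lambda_0$ (respectively at $\infty$) to the $p\times m$ matrix $\begin{bmatrix}\operatorname{diag}(t^{\nu_1},\ldots,t^{\nu_r})&0\\0&0\end{bmatrix}$ with $t=\lambda-\lambda_0$ (respectively $t=1/\lambda$). The *partial multiplicities at* $\lambda_0$ of a polynomial matrix are its nonzero invariant orders at $\lambda_0$, in nondecreasing order. The *degree* of a polynomial matrix is the largest degree of an entry ($0$ for the zero matrix), and $\operatorname{rev}_d M(\lambda):=\lambda^d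 M(1/\lambda)$. **Theorem.** Let $G(\lambda)\in\mathbb{F}(\lambda)^{p\times m}$ have normal rank $r$, and let $$P(\lambda)=\begin{bmatrix}A(\lambda)&B(\lambda)\\-C(\lambda)&D(\lambda)\end{bmatrix}\in\mathbb{F}[\lambda]^{(n+p)\times(n+m)},\qquad n\ge 0,$$ be a polynomial system matrix with transfer function matrix $G(\lambda)$; that is, $A(\lambda)$ is $n\times n$ with $\det A(\lambda)\not\equiv 0$, and $G(\lambda)=D(\lambda)+C(\lambda)A(\lambda)^{-1}B(\lambda)$ (for $n=0$, $P=G=D$). Let $d$ be the degree of $P(\lambda)$ and put $\operatorname{rev}P:=\operatorname{rev}_dP$. Assume that $P(\lambda)$ is minimal at $\infty$, that is, $$\operatorname{rank}\begin{bmatrix}(\operatorname{rev}_dA)(0)\\(\operatorname{rev}_dC)(0)\end{bmatrix}=\operatorname{rank}\begin{bmatrix}(\operatorname{rev}_dA)(0)&(\operatorname{rev}_dB)(0)\end{bmatrix}=n$$ (no condition if $n=0$). Then the partial multiplicities $e_1\le\cdots\le e_s$ of $\operatorname{rev}_dA(\lambda)$ at $0$ and the partial multiplicities $\widetilde e_1\le\cdots\le\widetilde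 e_u$ of $\operatorname{rev}P(\lambda)$ at $0$ are well defined, $s+u\le r$, and the invariant orders at infinity $q_1\le q_2\le\cdots\le q_r$ of $G(\lambda)$ are $$(q_1,q_2,\ldots,q_r)=(-e_s,-e_{s-1},\ldots,-e_1,\underbrace{0,\ldots,0}_{r-s-u},\widetilde e_1,\widetilde e_2,\ldots,\widetilde e_u)-(d,d,\ldots,d).$$ -/

import Mathlib

open Polynomial

noncomputable section

namespace RationalMatrix

variable {F : Type*} [Field F]

/-! ### Rational matrices: values, regularity, local equivalence -/

/-- The value `R(a)` of a rational matrix at a point `a` of the field (meaningful when `R` is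
defined at `a`). -/
def evalAt {p m : ℕ} (a : F) (R : Matrix (Fin p) (Fin m) (RatFunc F)) :
    Matrix (Fin p) (Fin m) F :=
  R.map (RatFunc.eval (RingHom.id F) a)

/-- `R` is defined (bounded) at `a`: no entry, written in lowest terms, has a denominator that
vanishes at `a`. -/
def IsDefinedAt {p m : ℕ} (a : F) (R : Matrix (Fin p) (Fin m) (RatFunc F)) : Prop :=
  ∀ i j, (R i j).denom.eval a ≠ 0

/-- `R` is regular (invertible) at `a`: it is defined at `a` and `det R(a) ≠ 0`. -/
def IsRegularAt {m : ℕ} (a : F) (R : Matrix (Fin m) (Fin m) (RatFunc F)) : Prop :=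
  IsDefinedAt a R ∧ (evalAt a R).det ≠ 0

/-- The rational function `f(1/X)`. -/
def substInv (f : RatFunc F) : RatFunc F :=
  f.eval (RatFunc.C : F →+* RatFunc F) (RatFunc.X)⁻¹

/-- `R` is regular at infinity: `R(1/X)` is regular at `0`. -/
def IsRegularAtInfinity {m : ℕ} (R : Matrix (Fin m) (Fin m) (RatFunc F)) : Prop :=
  IsRegularAt 0 (R.map substInv)

/-- Equivalence of rational matrices at a finite point `a`. -/
def EquivalentAt {p m : ℕ} (a : F) (G H : Matrix (Fin p) (Fin m) (RatFunc F)) : Prop :=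
  ∃ (R₁ : Matrix (Fin p) (Fin p) (RatFunc F)) (R₂ : Matrix (Fin m) (Fin m) (RatFunc F)),
    IsRegularAt a R₁ ∧ IsRegularAt a R₂ ∧ R₁ * G * R₂ = H

/-- Equivalence of rational matrices at infinity. -/
def EquivalentAtInfinity {p m : ℕ} (G H : Matrix (Fin p) (Fin m) (RatFunc F)) : Prop :=
  ∃ (R₁ : Matrix (Fin p) (Fin p) (RatFunc F)) (R₂ : Matrix (Fin m) (Fin m) (RatFunc F)),
    IsRegularAtInfinity R₁ ∧ IsRegularAtInfinity R₂ ∧ R₁ * G * R₂ = H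

/-! ### Local Smith–McMillan forms, invariant orders, partial multiplicities -/

/-- The `p × m` matrix whose leading diagonal entries are `t ^ ν₁, …, t ^ νᵣ` and whose other
entries are zero. -/
def diagPowers (p m : ℕ) (t : RatFunc F) (ν : List ℤ) : Matrix (Fin p) (Fin m) (RatFunc F) :=
  Matrix.of fun i j =>
    if i.val = j.val then (ν.map fun k => t ^ k).getD i.val 0 else 0

/-- `ν₁ ≤ ⋯ ≤ νᵣ` (with `r` the normal rank of `G`) are the invariant orders of `G` at `a`. -/
def IsInvariantOrdersAt {p m : ℕ} (a : F) (G : Matrix (Fin p) (Fin m) (RatFunc F))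
    (ν : List ℤ) : Prop :=
  ν.length = G.rank ∧ ν.Pairwise (· ≤ ·) ∧
    EquivalentAt a G (diagPowers p m (RatFunc.X - RatFunc.C a) ν)

/-- `μ₁ ≤ ⋯ ≤ μᵣ` (with `r` the normal rank of `G`) are the invariant orders of `G` at
infinity. -/
def IsInvariantOrdersAtInfinity {p m : ℕ} (G : Matrix (Fin p) (Fin m) (RatFunc F))
    (μ : List ℤ) : Prop :=
  μ.length = G.rank ∧ μ.Pairwise (· ≤ ·) ∧
    EquivalentAtInfinity G (diagPowers p m (1 / RatFunc.X) μ)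

/-- A polynomial matrix regarded as a rational matrix. -/
def toRat {p m : ℕ} (M : Matrix (Fin p) (Fin m) F[X]) : Matrix (Fin p) (Fin m) (RatFunc F) :=
  M.map (algebraMap F[X] (RatFunc F))

/-- `e₁ ≤ ⋯ ≤ eₛ` are the partial multiplicities at `a` of the polynomial matrix `M`: its
nonzero invariant orders at `a`, in nondecreasing order. -/
def IsPartialMultiplicitiesAt {p m : ℕ} (a : F) (M : Matrix (Fin p) (Fin m) F[X])
    (e : List ℤ) : Prop :=
  ∃ ν : List ℤ, IsInvariantOrdersAt a (toRat M) ν ∧ e = ν.filter (fun k => k ≠ 0)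

/-! ### Degrees and reversals -/

/-- The degree of a polynomial matrix: the largest degree of an entry (`0` for the zero
matrix). -/
def matrixDegree {p m : ℕ} (M : Matrix (Fin p) (Fin m) F[X]) : ℕ :=
  Finset.univ.sup fun i => Finset.univ.sup fun j => (M i j).natDegree

/-- The `g`-reversal `X ^ g * G(1/X)` of a rational matrix. -/
def ratRev {p m : ℕ} (g : ℤ) (G : Matrix (Fin p) (Fin m) (RatFunc F)) :
    Matrix (Fin p) (Fin m) (RatFunc F) :=
  G.map fun f => RatFunc.X ^ g * substInv f

/-- The `d`-reversal `X ^ d * M(1/X)` of a polynomial matrix of degree at most `d`, as a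
polynomial matrix: the coefficient of `X ^ k` becomes that of `X ^ (d - k)`. -/
def polyRev {p m : ℕ} (d : ℕ) (M : Matrix (Fin p) (Fin m) F[X]) : Matrix (Fin p) (Fin m) F[X] :=
  M.map (Polynomial.reflect d)

/-- `polyRev d M` is the `d`-reversal of `M` in the sense of rational matrices. -/
theorem toRat_polyRev {p m : ℕ} (d : ℕ) (M : Matrix (Fin p) (Fin m) F[X])
    (h : matrixDegree M ≤ d) : toRat (polyRev d M) = ratRev (d : ℤ) (toRat M) := by
  ext i j : 2
  have hij : (M i j).natDegree ≤ d :=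
    ((Finset.le_sup (f := fun j => (M i j).natDegree) (Finset.mem_univ j)).trans
      (Finset.le_sup (f := fun i => Finset.univ.sup fun j => (M i j).natDegree)
        (Finset.mem_univ i))).trans h
  have hX : (RatFunc.X : RatFunc F) ≠ 0 := RatFunc.X_ne_zero
  let _ : Invertible (RatFunc.X⁻¹ : RatFunc F) := invertibleOfNonzero (inv_ne_zero hX)
  have key := Polynomial.eval₂_reflect_mul_pow (RatFunc.C : F →+* RatFunc F)
    (RatFunc.X⁻¹ : RatFunc F) d (M i j) hij
  have hinv : (⅟(RatFunc.X⁻¹ : RatFunc F)) = RatFunc.X := by simp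
  have h2 : ∀ q : F[X], eval₂ (RatFunc.C : F →+* RatFunc F) RatFunc.X q
      = algebraMap F[X] (RatFunc F) q := by
    intro q
    rw [← RatFunc.algebraMap_X, ← RatFunc.algebraMap_comp_C, ← Polynomial.hom_eval₂,
      Polynomial.eval₂_C_X]
  rw [hinv, h2] at key
  simp only [toRat, polyRev, ratRev, substInv, Matrix.map_apply, RatFunc.eval_algebraMap,
    zpow_natCast]
  rw [Algebra.algebraMap_self, RingHom.id_apply, ← key, mul_left_comm, ← mul_pow,
    mul_inv_cancel₀ hX, one_pow, mul_one]

/-! ### Polynomial system matrices -/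

/-- The matrix `[A, B; -C, D]`. -/
def systemMatrix {n p m : ℕ} (A : Matrix (Fin n) (Fin n) F[X]) (B : Matrix (Fin n) (Fin m) F[X])
    (C : Matrix (Fin p) (Fin n) F[X]) (D : Matrix (Fin p) (Fin m) F[X]) :
    Matrix (Fin (n + p)) (Fin (n + m)) F[X] :=
  Matrix.reindex finSumFinEquiv finSumFinEquiv (Matrix.fromBlocks A B (-C) D)

theorem polyRev_systemMatrix {n p m : ℕ} (d : ℕ) (A : Matrix (Fin n) (Fin n) F[X])
    (B : Matrix (Fin n) (Fin m) F[X]) (C : Matrix (Fin p) (Fin n) F[X])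
    (D : Matrix (Fin p) (Fin m) F[X]) :
    polyRev d (systemMatrix A B C D) =
      systemMatrix (polyRev d A) (polyRev d B) (polyRev d C) (polyRev d D) := by
  have hneg : ∀ f : F[X], Polynomial.reflect d (-f) = -Polynomial.reflect d f := by
    intro f
    rw [← neg_one_mul f, ← Polynomial.C_1, ← Polynomial.C_neg, Polynomial.reflect_C_mul]
    simp
  simp only [polyRev, systemMatrix, Matrix.reindex_apply, ← Matrix.submatrix_map,
    Matrix.fromBlocks_map]
  congr 2
  ext i j : 2
  simp [hneg]

/-- `[A, B; -C, D]` is a polynomial system matrix with state matrix `A` and transfer function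
matrix `G`: the matrix `A` is nonsingular and `G = D + C A⁻¹ B`. -/
def IsSystemMatrixOf {n p m : ℕ} (A : Matrix (Fin n) (Fin n) F[X])
    (B : Matrix (Fin n) (Fin m) F[X]) (C : Matrix (Fin p) (Fin n) F[X])
    (D : Matrix (Fin p) (Fin m) F[X]) (G : Matrix (Fin p) (Fin m) (RatFunc F)) : Prop :=
  A.det ≠ 0 ∧ G = toRat D + toRat C * (toRat A)⁻¹ * toRat B

/-- `[A, B; -C, D]`, with `A` of size `n`, is minimal at `a`:
`rank [A(a); C(a)] = rank [A(a), B(a)] = n` (automatic when `n = 0`). -/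
def IsMinimalAt {n p m : ℕ} (a : F) (A : Matrix (Fin n) (Fin n) F[X])
    (B : Matrix (Fin n) (Fin m) F[X]) (C : Matrix (Fin p) (Fin n) F[X]) : Prop :=
  (Matrix.fromRows (A.map (Polynomial.eval a)) (C.map (Polynomial.eval a))).rank = n ∧
    (Matrix.fromCols (A.map (Polynomial.eval a)) (B.map (Polynomial.eval a))).rank = n

/-- `P = [A, B; -C, D]` is minimal at infinity: the reversal `rev_d P`, where `d` is the degree
of `P`, is minimal at `0`. -/
def IsMinimalAtInfinity {n p m : ℕ} (A : Matrix (Fin n) (Fin n) F[X])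
    (B : Matrix (Fin n) (Fin m) F[X]) (C : Matrix (Fin p) (Fin n) F[X])
    (D : Matrix (Fin p) (Fin m) F[X]) : Prop :=
  IsMinimalAt 0 (polyRev (matrixDegree (systemMatrix A B C D)) A)
    (polyRev (matrixDegree (systemMatrix A B C D)) B)
    (polyRev (matrixDegree (systemMatrix A B C D)) C)

end RationalMatrix

end

/-!
The reversal `λ ↦ 1/λ` is an automorphism of `F(λ)` that carries the point at infinity to `0`, so
the invariant orders of `G` at infinity are those of `G(1/λ)` at `0`. Since
`λ ^ d G(1/λ)` is the transfer function of `rev P`, whose state matrix is `rev A`, and since the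
factor `λ ^ d` shifts every order by `d`, the theorem is a statement at `0` about a polynomial
system matrix that is minimal there.

That statement holds over any discrete valuation ring `O` with uniformizer `t` and fraction field
`K`. Over `O`, every matrix over `K` is equivalent to `diag(t ^ ν₁, …, t ^ νᵣ) ⊕ 0`
(`HasOrders.exists_hasOrders`, by pivoting on an entry of least order), with a unique multiset of
exponents (`HasOrders.unique`, which rests on the rank count `LocalEquiv.card_le`).

Let `P = [A, B; -C, D]` be over `O`. Minimality gives, by lifting one-sided inverses over the
residue field, identities `X A + Y C = 1` and `A X' + B Y' = 1` over `O`. The unit invariant factors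
of `A` can be split off from `A` and eliminated from `P` without changing the transfer function
(`localEquiv_fromBlocks_fromBlocks`), so that `A` may be taken to be `E = diag(t ^ εᵢ)` with all
`εᵢ > 0`. Pad `P` and `G` with a zero block of the size of `E`. Using `X, Y, X', Y'`, unimodular row
and column operations turn the padding of `P` into identity blocks in the rows and columns of `E`,
and the same operations turn the zero block of `G ⊕ 0` into `S - E⁻¹ = -(1 - S E) E⁻¹`. As `E`
vanishes modulo `t`, the matrix `1 - S E` is invertible over `O`. Eliminating with these blocks
yields the same matrix `T` over `O` on both sides: `P ⊕ 0` is equivalent to `1 ⊕ 1 ⊕ T`, and `G ⊕ 0`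
to `E⁻¹ ⊕ T` (`exists_localEquiv_system`). So the nonzero orders of `P` are those of `T`, and the
orders of `G` are the `-εᵢ` together with those of `T`. This is `exists_orders_system`.
-/

noncomputable section

namespace RationalMatrix
open Matrix

/-! ### Matrices over a discrete valuation ring -/

section LocalRing

variable {K : Type*} [Field K]

/-- `O` is a discrete valuation ring with fraction field `K` and uniformizer `t`: every nonzero
element of `K` is a power of `t` times a unit of `O`, and `t` is a non-unit of `O`. -/
structure IsUniformizer (O : Subring K) (t : K) : Prop where
  mem : t ∈ O
  inv_notMem : t⁻¹ ∉ O
  exists_zpow : ∀ x : K, x ≠ 0 → ∃ (k : ℤ) (u : K), u ∈ O ∧ u⁻¹ ∈ O ∧ x = t ^ k * u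

variable {O : Subring K} {t : K}

theorem IsUniformizer.ne_zero (h : IsUniformizer O t) : t ≠ 0 := by
  rintro rfl
  exact h.inv_notMem (by simp)

theorem IsUniformizer.zpow_mem (h : IsUniformizer O t) {k : ℤ} : t ^ k ∈ O ↔ 0 ≤ k := by
  constructor
  · intro hk
    by_contra! hneg
    apply h.inv_notMem
    have h1 : t⁻¹ = t ^ k * t ^ (-k - 1) := by
      rw [← zpow_add₀ h.ne_zero, ← _root_.zpow_neg_one]
      congr 1
      ring
    rw [h1]
    obtain ⟨j, hj⟩ : ∃ j : ℕ, -k - 1 = j := ⟨(-k - 1).toNat, by omega⟩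
    rw [hj, zpow_natCast]
    exact O.mul_mem hk (O.pow_mem h.mem j)
  · intro hk
    obtain ⟨j, rfl⟩ := Int.eq_ofNat_of_zero_le hk
    rw [zpow_natCast]
    exact O.pow_mem h.mem j

theorem IsUniformizer.inv_one_sub_mul_mem (h : IsUniformizer O t) {x : K} (hx : x ∈ O) :
    1 - t * x ≠ 0 ∧ (1 - t * x)⁻¹ ∈ O := by
  have h0 : 1 - t * x ≠ 0 := by
    intro h1
    apply h.inv_notMem
    have : t⁻¹ = x := inv_eq_of_mul_eq_one_right (sub_eq_zero.mp h1).symm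
    rwa [this]
  refine ⟨h0, ?_⟩
  obtain ⟨k, u, hu, hui, e⟩ := h.exists_zpow _ h0
  have hu0 : u ≠ 0 := by rintro rfl; simp [e] at h0
  have hmem : 1 - t * x ∈ O := O.sub_mem O.one_mem (O.mul_mem h.mem hx)
  have hk : 0 ≤ k := by
    rw [← h.zpow_mem (k := k)]
    have : t ^ k = (1 - t * x) * u⁻¹ := by rw [e, mul_assoc, mul_inv_cancel₀ hu0, mul_one]
    rw [this]
    exact O.mul_mem hmem hui
  rcases hk.eq_or_lt with rfl | hk
  · rw [e]; simpa using hui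
  · exfalso
    apply h.inv_notMem
    have h1 : t⁻¹ = x + t ^ (k - 1) * u := by
      have : t * (x + t ^ (k - 1) * u) = 1 := by
        have : t * (t ^ (k - 1) * u) = t ^ k * u := by
          rw [← mul_assoc, ← zpow_one_add₀ h.ne_zero, add_sub_cancel]
        rw [mul_add, this, ← e]; ring
      exact inv_eq_of_mul_eq_one_right this
    rw [h1]
    exact O.add_mem hx (O.mul_mem (h.zpow_mem.2 (by omega)) hu)

/-- The entries of `M`, a matrix over `K`, lie in the subring `O`. Matrices over `O` are encoded in
this way throughout, so that products with matrices over `K` need no coercions. -/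
def IntegralMatrix {ι κ : Type*} (O : Subring K) (M : Matrix ι κ K) : Prop := ∀ i j, M i j ∈ O

namespace IntegralMatrix

variable {ι κ μ ι' κ' : Type*} {M N : Matrix ι κ K}

theorem zero : IntegralMatrix O (0 : Matrix ι κ K) := fun _ _ => O.zero_mem

theorem one [DecidableEq ι] : IntegralMatrix O (1 : Matrix ι ι K) := fun i j => by
  rw [Matrix.one_apply]; split_ifs; exacts [O.one_mem, O.zero_mem]

theorem add (hM : IntegralMatrix O M) (hN : IntegralMatrix O N) : IntegralMatrix O (M + N) :=
  fun i j => O.add_mem (hM i j) (hN i j)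

theorem sub (hM : IntegralMatrix O M) (hN : IntegralMatrix O N) : IntegralMatrix O (M - N) :=
  fun i j => O.sub_mem (hM i j) (hN i j)

theorem neg (hM : IntegralMatrix O M) : IntegralMatrix O (-M) :=
  fun i j => O.neg_mem (hM i j)

theorem mul [Fintype κ] {N : Matrix κ μ K} (hM : IntegralMatrix O M) (hN : IntegralMatrix O N) :
    IntegralMatrix O (M * N) := fun i j => by
  rw [Matrix.mul_apply]
  exact O.sum_mem fun k _ => O.mul_mem (hM i k) (hN k j)

theorem smul {c : K} (hc : c ∈ O) (hM : IntegralMatrix O M) : IntegralMatrix O (c • M) :=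
  fun i j => O.mul_mem hc (hM i j)

theorem submatrix (hM : IntegralMatrix O M) (f : ι' → ι) (g : κ' → κ) :
    IntegralMatrix O (M.submatrix f g) := fun _ _ => hM _ _

theorem fromBlocks {A : Matrix ι κ K} {B : Matrix ι κ' K} {C : Matrix ι' κ K}
    {D : Matrix ι' κ' K} (hA : IntegralMatrix O A) (hB : IntegralMatrix O B)
    (hC : IntegralMatrix O C) (hD : IntegralMatrix O D) :
    IntegralMatrix O (Matrix.fromBlocks A B C D) := by
  rintro (i | i) (j | j)
  exacts [hA i j, hB i j, hC i j, hD i j]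

theorem fromCols {A : Matrix ι κ K} {B : Matrix ι κ' K} (hA : IntegralMatrix O A)
    (hB : IntegralMatrix O B) : IntegralMatrix O (Matrix.fromCols A B) := by
  rintro i (j | j)
  exacts [hA i j, hB i j]

theorem fromRows {A : Matrix ι κ K} {C : Matrix ι' κ K} (hA : IntegralMatrix O A)
    (hC : IntegralMatrix O C) : IntegralMatrix O (Matrix.fromRows A C) := by
  rintro (i | i) j
  exacts [hA i j, hC i j]

theorem exists_map_subtype (hM : IntegralMatrix O M) :
    ∃ M' : Matrix ι κ O, M = M'.map O.subtype :=
  ⟨Matrix.of fun i j => ⟨M i j, hM i j⟩, rfl⟩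

theorem map_subtype (M' : Matrix ι κ O) : IntegralMatrix O (M'.map O.subtype) :=
  fun i j => (M' i j).2

end IntegralMatrix

/-- `U` is invertible over `O`, with inverse `U'`. The row and column index types may differ (they
then have the same cardinality), so that reindexing is a special case of multiplication by such
matrices. -/
structure IsIntegralInverse {ι κ : Type*} [Fintype ι] [Fintype κ] [DecidableEq ι]
    [DecidableEq κ] (O : Subring K) (U : Matrix ι κ K) (U' : Matrix κ ι K) : Prop where
  integral : IntegralMatrix O U
  integral_inv : IntegralMatrix O U'
  mul_inv : U * U' = 1
  inv_mul : U' * U = 1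

theorem exists_integralInverse_of_isUnit_det {ι : Type*} [Fintype ι] [DecidableEq ι]
    {M : Matrix ι ι O} (hM : IsUnit M.det) :
    ∃ V, IsIntegralInverse O (M.map O.subtype) V := by
  refine ⟨M⁻¹.map O.subtype, IntegralMatrix.map_subtype _, IntegralMatrix.map_subtype _, ?_, ?_⟩
  · rw [← Matrix.map_mul, Matrix.mul_nonsing_inv _ hM]
    exact Matrix.map_one _ (map_zero _) (map_one _)
  · rw [← Matrix.map_mul, Matrix.nonsing_inv_mul _ hM]
    exact Matrix.map_one _ (map_zero _) (map_one _)

theorem IsUniformizer.exists_integralInverse_one_sub (h : IsUniformizer O t) {ι : Type*}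
    [Fintype ι] [DecidableEq ι] {M : Matrix ι ι K} (hM : IntegralMatrix O M) :
    ∃ V, IsIntegralInverse O (1 - t • M) V := by
  obtain ⟨M', rfl⟩ := hM.exists_map_subtype
  set T : O := ⟨t, h.mem⟩ with hT
  have e : (1 - t • M'.map O.subtype) = (1 - T • M').map O.subtype := by
    ext i j
    by_cases hij : i = j <;> simp [hT, hij]
  -- `1 - T • M'` is the identity modulo `T`
  have hdet : ∃ x : O, (1 - T • M').det = 1 - T * x := by
    have hdvd : T ∣ (1 - T • M').det - 1 := by
      rw [← Ideal.mem_span_singleton, ← Ideal.Quotient.eq_zero_iff_mem, map_sub, map_one,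
        RingHom.map_det]
      have : (Ideal.Quotient.mk (Ideal.span {T})).mapMatrix (1 - T • M') = 1 := by
        rw [map_sub, map_one, sub_eq_self]
        ext i j
        simp only [RingHom.mapMatrix_apply, Matrix.map_apply, Matrix.smul_apply, Matrix.zero_apply,
          smul_eq_mul]
        exact Ideal.Quotient.eq_zero_iff_mem.2
          (Ideal.mul_mem_right _ _ (Ideal.mem_span_singleton_self T))
      rw [this, det_one, sub_self]
    obtain ⟨y, hy⟩ := hdvd
    exact ⟨-y, by linear_combination hy⟩
  obtain ⟨x, hx⟩ := hdet
  obtain ⟨hne, hinv⟩ := h.inv_one_sub_mul_mem x.2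
  have hunit : IsUnit (1 - T • M').det := by
    rw [hx]
    refine IsUnit.of_mul_eq_one ⟨_, hinv⟩ ?_
    apply Subtype.ext
    simpa [hT] using mul_inv_cancel₀ hne
  rw [e]
  exact exists_integralInverse_of_isUnit_det hunit

section Equivalence

variable {ι κ ι' κ' ι'' κ'' α β α' β' : Type*}
  [Fintype ι] [Fintype κ] [Fintype ι'] [Fintype κ'] [Fintype ι''] [Fintype κ'']
  [Fintype α] [Fintype β] [Fintype α'] [Fintype β']
  [DecidableEq ι] [DecidableEq κ] [DecidableEq ι'] [DecidableEq κ'] [DecidableEq ι'']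
  [DecidableEq κ''] [DecidableEq α] [DecidableEq β] [DecidableEq α'] [DecidableEq β']

namespace IsIntegralInverse

theorem symm {U : Matrix ι κ K} {U' : Matrix κ ι K} (h : IsIntegralInverse O U U') :
    IsIntegralInverse O U' U :=
  ⟨h.integral_inv, h.integral, h.inv_mul, h.mul_inv⟩

theorem one : IsIntegralInverse O (1 : Matrix ι ι K) 1 :=
  ⟨.one, .one, one_mul 1, one_mul 1⟩

theorem mul {U : Matrix ι κ K} {U' : Matrix κ ι K} {V : Matrix κ α K} {V' : Matrix α κ K}
    (hU : IsIntegralInverse O U U') (hV : IsIntegralInverse O V V') :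
    IsIntegralInverse O (U * V) (V' * U') := by
  refine ⟨hU.integral.mul hV.integral, hV.integral_inv.mul hU.integral_inv, ?_, ?_⟩
  · rw [Matrix.mul_assoc, ← Matrix.mul_assoc V, hV.mul_inv, Matrix.one_mul, hU.mul_inv]
  · rw [Matrix.mul_assoc, ← Matrix.mul_assoc U', hU.inv_mul, Matrix.one_mul, hV.inv_mul]

theorem fromBlocks {U : Matrix ι κ K} {U' : Matrix κ ι K} {V : Matrix ι' κ' K}
    {V' : Matrix κ' ι' K} (hU : IsIntegralInverse O U U') (hV : IsIntegralInverse O V V') :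
    IsIntegralInverse O (Matrix.fromBlocks U 0 0 V) (Matrix.fromBlocks U' 0 0 V') := by
  refine ⟨hU.integral.fromBlocks .zero .zero hV.integral,
    hU.integral_inv.fromBlocks .zero .zero hV.integral_inv, ?_, ?_⟩
  · simp [fromBlocks_multiply, hU.mul_inv, hV.mul_inv]
  · simp [fromBlocks_multiply, hU.inv_mul, hV.inv_mul]

theorem lower {X : Matrix κ ι K} (hX : IntegralMatrix O X) :
    IsIntegralInverse O (Matrix.fromBlocks 1 0 X 1) (Matrix.fromBlocks 1 0 (-X) 1) := by
  refine ⟨.fromBlocks .one .zero hX .one, .fromBlocks .one .zero hX.neg .one, ?_, ?_⟩ <;>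
    simp [fromBlocks_multiply]

theorem upper {X : Matrix ι κ K} (hX : IntegralMatrix O X) :
    IsIntegralInverse O (Matrix.fromBlocks 1 X 0 1) (Matrix.fromBlocks 1 (-X) 0 1) := by
  refine ⟨.fromBlocks .one hX .zero .one, .fromBlocks .one hX.neg .zero .one, ?_, ?_⟩ <;>
    simp [fromBlocks_multiply]

theorem reindex (e : ι ≃ κ) :
    IsIntegralInverse O ((1 : Matrix κ κ K).submatrix e id)
      ((1 : Matrix κ κ K).submatrix id e) := by
  refine ⟨IntegralMatrix.one.submatrix _ _, IntegralMatrix.one.submatrix _ _, ?_, ?_⟩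
  · rw [← submatrix_mul _ _ e id e Function.bijective_id, one_mul, submatrix_one_equiv]
  · rw [← submatrix_mul _ _ id e id e.bijective, one_mul, submatrix_id_id]

theorem card_eq {U : Matrix ι κ K} {U' : Matrix κ ι K} (h : IsIntegralInverse O U U') :
    Fintype.card ι = Fintype.card κ := by
  have h1 := rank_mul_le_left U U'
  have h2 := rank_mul_le_left U' U
  rw [h.mul_inv, rank_one] at h1
  rw [h.inv_mul, rank_one] at h2
  exact le_antisymm (h1.trans (rank_le_card_width U)) (h2.trans (rank_le_card_width U'))

end IsIntegralInverse

/-- `M` and `N` are equivalent over `O`, possibly after reindexing. -/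
def LocalEquiv (O : Subring K) (M : Matrix ι κ K) (N : Matrix ι' κ' K) : Prop :=
  ∃ (U : Matrix ι' ι K) (U' : Matrix ι ι' K) (V : Matrix κ κ' K) (V' : Matrix κ' κ K),
    IsIntegralInverse O U U' ∧ IsIntegralInverse O V V' ∧ U * M * V = N

namespace LocalEquiv

theorem refl (M : Matrix ι κ K) : LocalEquiv O M M :=
  ⟨1, 1, 1, 1, .one, .one, by simp⟩

theorem symm {M : Matrix ι κ K} {N : Matrix ι' κ' K} (h : LocalEquiv O M N) :
    LocalEquiv O N M := by
  obtain ⟨U, U', V, V', hU, hV, rfl⟩ := h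
  refine ⟨U', U, V', V, hU.symm, hV.symm, ?_⟩
  rw [Matrix.mul_assoc U, ← Matrix.mul_assoc U', hU.inv_mul, Matrix.one_mul, Matrix.mul_assoc,
    hV.mul_inv, Matrix.mul_one]

theorem trans {M : Matrix ι κ K} {N : Matrix ι' κ' K} {L : Matrix ι'' κ'' K}
    (h : LocalEquiv O M N) (h' : LocalEquiv O N L) : LocalEquiv O M L := by
  obtain ⟨U, U', V, V', hU, hV, rfl⟩ := h
  obtain ⟨U₂, U₂', V₂, V₂', hU₂, hV₂, rfl⟩ := h'
  exact ⟨_, _, _, _, hU₂.mul hU, hV.mul hV₂, by simp only [Matrix.mul_assoc]⟩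

theorem mul_left {U : Matrix ι' ι K} {U' : Matrix ι ι' K} (hU : IsIntegralInverse O U U')
    (M : Matrix ι κ K) : LocalEquiv O M (U * M) :=
  ⟨U, U', 1, 1, hU, .one, by simp⟩

theorem submatrix (M : Matrix ι κ K) (e : ι' ≃ ι) (f : κ' ≃ κ) :
    LocalEquiv O M (M.submatrix e f) := by
  refine ⟨_, _, _, _, .reindex e, (IsIntegralInverse.reindex f).symm, ?_⟩
  ext i j
  simp [Matrix.mul_apply, Matrix.one_apply]

theorem fromBlocks {M : Matrix ι κ K} {N : Matrix ι' κ' K} {M' : Matrix α β K}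
    {N' : Matrix α' β' K} (h : LocalEquiv O M N) (h' : LocalEquiv O M' N') :
    LocalEquiv O (Matrix.fromBlocks M 0 0 M') (Matrix.fromBlocks N 0 0 N') := by
  obtain ⟨U, U', V, V', hU, hV, rfl⟩ := h
  obtain ⟨U₂, U₂', V₂, V₂', hU₂, hV₂, rfl⟩ := h'
  exact ⟨_, _, _, _, hU.fromBlocks hU₂, hV.fromBlocks hV₂, by simp [fromBlocks_multiply]⟩

/-- Block elimination: an off-diagonal block that is an `O`-multiple of the pivot block `A` can be
cleared. The block `A` need not be invertible, nor have entries in `O`. -/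
theorem eliminate (A : Matrix ι κ K) (D : Matrix ι' κ' K) {X : Matrix ι' ι K} {Y : Matrix κ κ' K}
    (hX : IntegralMatrix O X) (hY : IntegralMatrix O Y) :
    LocalEquiv O (Matrix.fromBlocks A (A * Y) (X * A) D)
      (Matrix.fromBlocks A 0 0 (D - X * A * Y)) := by
  refine ⟨_, _, _, _, .lower hX.neg, .upper hY.neg, ?_⟩
  simp [fromBlocks_multiply, Matrix.mul_assoc, sub_eq_add_neg]
  abel

theorem smul {M : Matrix ι κ K} {N : Matrix ι' κ' K} (c : K) (h : LocalEquiv O M N) :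
    LocalEquiv O (c • M) (c • N) := by
  obtain ⟨U, U', V, V', hU, hV, rfl⟩ := h
  exact ⟨_, _, _, _, hU, hV, by simp⟩

theorem integral {M : Matrix ι κ K} {N : Matrix ι' κ' K} (h : LocalEquiv O M N)
    (hM : IntegralMatrix O M) : IntegralMatrix O N := by
  obtain ⟨U, U', V, V', hU, hV, rfl⟩ := h
  exact (hU.integral.mul hM).mul hV.integral

theorem card_eq {M : Matrix ι κ K} {N : Matrix ι' κ' K} (h : LocalEquiv O M N) :
    Fintype.card ι' = Fintype.card ι ∧ Fintype.card κ' = Fintype.card κ := by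
  obtain ⟨U, U', V, V', hU, hV, rfl⟩ := h
  exact ⟨hU.card_eq, hV.card_eq.symm⟩

theorem rank_le {M : Matrix ι κ K} {N : Matrix ι' κ' K} (h : LocalEquiv O M N) :
    N.rank ≤ M.rank := by
  obtain ⟨U, U', V, V', hU, hV, rfl⟩ := h
  exact (rank_mul_le_left _ _).trans (rank_mul_le_right _ _)

theorem rank_eq {M : Matrix ι κ K} {N : Matrix ι' κ' K} (h : LocalEquiv O M N) :
    M.rank = N.rank :=
  le_antisymm h.symm.rank_le h.rank_le

end LocalEquiv

end Equivalence

end LocalRing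

/-! ### Local Smith-McMillan forms: existence and uniqueness -/

section Orders

variable {K : Type*} [Field K] {O : Subring K} {t : K}

/-- `s` is the multiset of invariant orders of `M` over the discrete valuation ring `O` with
uniformizer `t`: `M` is equivalent over `O` to `diag(t ^ ν) ⊕ 0`, where `ν` enumerates `s`. The
index types of the blocks are existentially quantified, so that direct sums of such forms are again
of this shape. -/
def HasOrders {ι κ : Type*} [Fintype ι] [Fintype κ] [DecidableEq ι] [DecidableEq κ]
    (O : Subring K) (t : K) (M : Matrix ι κ K) (s : Multiset ℤ) : Prop :=
  ∃ (ρ α β : Type) (_ : Fintype ρ) (_ : Fintype α) (_ : Fintype β) (_ : DecidableEq ρ)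
    (_ : DecidableEq α) (_ : DecidableEq β) (ν : ρ → ℤ),
    s = Finset.univ.val.map ν ∧
      LocalEquiv O M (Matrix.fromBlocks (diagonal fun i => t ^ ν i) 0 0 (0 : Matrix α β K))

section Rank

variable {ρ α β : Type*} [Fintype ρ] [DecidableEq ρ]

theorem fromBlocks_zero_eq_mul (A : Matrix ρ ρ K) :
    Matrix.fromBlocks A 0 0 (0 : Matrix α β K) =
      Matrix.fromRows (1 : Matrix ρ ρ K) (0 : Matrix α ρ K) * A *
        Matrix.fromCols (1 : Matrix ρ ρ K) (0 : Matrix ρ β K) := by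
  rw [Matrix.fromRows_mul, Matrix.fromRows_mul_fromCols]
  simp

theorem mul_fromBlocks_zero_mul [Fintype α] [Fintype β] (A : Matrix ρ ρ K) :
    Matrix.fromCols (1 : Matrix ρ ρ K) (0 : Matrix ρ α K) *
      Matrix.fromBlocks A 0 0 (0 : Matrix α β K) *
        Matrix.fromRows (1 : Matrix ρ ρ K) (0 : Matrix β ρ K) = A := by
  rw [fromCols_mul_fromBlocks, fromCols_mul_fromRows]
  simp

theorem rank_fromBlocks_zero [Fintype α] [Fintype β] (A : Matrix ρ ρ K) :
    (Matrix.fromBlocks A 0 0 (0 : Matrix α β K)).rank = A.rank := by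
  apply le_antisymm
  · rw [fromBlocks_zero_eq_mul]
    exact (rank_mul_le_left _ _).trans (rank_mul_le_right _ _)
  · conv_lhs => rw [← mul_fromBlocks_zero_mul (α := α) (β := β) A]
    exact (rank_mul_le_left _ _).trans (rank_mul_le_right _ _)

end Rank

/-- The number of exponents at most `k` does not increase along an equivalence of Smith-McMillan
forms. Modulo `t ^ (k + 1)`, the matrix with exponents `ν'` has rank at most the number of
`ν' i ≤ k`, while the matrix with exponents `ν` can be rescaled to `t ^ k` times the projection `E` onto the indices
with `ν i ≤ k`; the error term is absorbed in an invertible factor `1 - t • _`. -/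
theorem LocalEquiv.card_le {ρ α β ρ' α' β' : Type*}
    [Fintype ρ] [Fintype α] [Fintype β] [DecidableEq ρ] [DecidableEq α] [DecidableEq β]
    [Fintype ρ'] [Fintype α'] [Fintype β'] [DecidableEq ρ'] [DecidableEq α'] [DecidableEq β']
    (h : IsUniformizer O t) {ν : ρ → ℤ} {ν' : ρ' → ℤ}
    (e : LocalEquiv O (Matrix.fromBlocks (diagonal fun i => t ^ ν' i) 0 0 (0 : Matrix α' β' K))
      (Matrix.fromBlocks (diagonal fun i => t ^ ν i) 0 0 (0 : Matrix α β K))) (k : ℤ) :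
    Fintype.card {i // ν i ≤ k} ≤ Fintype.card {i // ν' i ≤ k} := by
  classical
  have ht := h.ne_zero
  obtain ⟨U, U', V, V', hU, hV, e⟩ := e
  set D₁ : Matrix (ρ' ⊕ α') (ρ' ⊕ β') K :=
    Matrix.fromBlocks (diagonal fun i => if ν' i ≤ k then t ^ ν' i else 0) 0 0 0 with hD₁
  set R : Matrix (ρ' ⊕ α') (ρ' ⊕ β') K :=
    Matrix.fromBlocks (diagonal fun i => if ν' i ≤ k then 0 else t ^ (ν' i - k - 1)) 0 0 0 with hR
  have hRint : IntegralMatrix O R := by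
    refine .fromBlocks ?_ .zero .zero .zero
    intro i j
    rw [diagonal_apply]
    split_ifs
    · exact O.zero_mem
    · exact h.zpow_mem.2 (by omega)
    · exact O.zero_mem
  have hsplit : Matrix.fromBlocks (diagonal fun i => t ^ ν' i) 0 0 (0 : Matrix α' β' K) =
      D₁ + t ^ (k + 1) • R := by
    rw [hD₁, hR, fromBlocks_smul, fromBlocks_add, ← diagonal_smul, diagonal_add]
    simp only [smul_zero, add_zero]
    congr 2
    ext i
    by_cases hi : ν' i ≤ k
    · simp [hi]
    · simp only [hi, if_false, Pi.smul_apply, smul_eq_mul, zero_add]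
      rw [← zpow_add₀ ht]
      congr 1
      ring
  set E : Matrix ρ ρ K := diagonal fun i => if ν i ≤ k then 1 else 0 with hE
  set Δ : Matrix ρ ρ K := diagonal fun i => if ν i ≤ k then t ^ (k - ν i) else 0 with hΔ
  have hΔint : IntegralMatrix O Δ := by
    intro i j
    rw [hΔ, diagonal_apply]
    split_ifs
    · exact h.zpow_mem.2 (by omega)
    · exact O.zero_mem
    · exact O.zero_mem
  set L : Matrix ρ (ρ' ⊕ α') K := Δ * Matrix.fromCols (1 : Matrix ρ ρ K) (0 : Matrix ρ α K) * U
    with hL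
  set W : Matrix (ρ' ⊕ β') ρ K := V * Matrix.fromRows (1 : Matrix ρ ρ K) (0 : Matrix β ρ K)
    with hW
  have hLint : IntegralMatrix O L := (hΔint.mul (.fromCols .one .zero)).mul hU.integral
  have hWint : IntegralMatrix O W := hV.integral.mul (.fromRows .one .zero)
  have key : t ^ k • E = L * D₁ * W + t ^ (k + 1) • (L * R * W) := by
    have h1 : t ^ k • E = Δ * diagonal fun i => t ^ ν i := by
      rw [hE, hΔ, diagonal_mul_diagonal, ← diagonal_smul]
      congr 1
      ext i
      by_cases hi : ν i ≤ k
      · simp [hi, ← zpow_add₀ ht]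
      · simp [hi]
    rw [h1, ← mul_fromBlocks_zero_mul (α := α) (β := β) (diagonal fun i => t ^ ν i), ← e, hsplit,
      hL, hW]
    simp only [Matrix.mul_add, Matrix.add_mul, Matrix.mul_smul, Matrix.smul_mul, Matrix.mul_assoc]
  have key' : E * (t ^ k)⁻¹ • (L * D₁ * W) = E * (1 - t • (L * R * W)) := by
    have h2 : L * D₁ * W = t ^ k • E - t ^ (k + 1) • (L * R * W) := by
      rw [key, add_sub_cancel_right]
    have hEE : E * E = E := by
      rw [hE, diagonal_mul_diagonal]
      congr 1
      ext i
      split_ifs <;> simp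
    rw [h2, smul_sub, smul_smul, smul_smul, inv_mul_cancel₀ (zpow_ne_zero _ ht), one_smul,
      zpow_add_one₀ ht, ← mul_assoc, inv_mul_cancel₀ (zpow_ne_zero _ ht), one_mul, Matrix.mul_sub,
      Matrix.mul_sub, hEE, Matrix.mul_one]
  obtain ⟨Q, hQ⟩ := h.exists_integralInverse_one_sub ((hLint.mul hRint).mul hWint)
  have key2 : E = E * (t ^ k)⁻¹ • (L * D₁ * W) * Q := by
    rw [key', Matrix.mul_assoc, hQ.mul_inv, Matrix.mul_one]
  have hrank : E.rank ≤ D₁.rank := by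
    rw [key2]
    refine (rank_mul_le_left _ Q).trans ((rank_mul_le_right E _).trans ?_)
    rw [← Matrix.smul_mul, ← Matrix.smul_mul]
    exact (rank_mul_le_left _ W).trans (rank_mul_le_right _ D₁)
  rw [hD₁, rank_fromBlocks_zero, hE, rank_diagonal, rank_diagonal] at hrank
  have e1 : {i // (if ν i ≤ k then (1 : K) else 0) ≠ 0} ≃ {i // ν i ≤ k} :=
    Equiv.subtypeEquivRight fun i => by simp
  have e2 : {i // (if ν' i ≤ k then t ^ ν' i else 0) ≠ 0} ≃ {i // ν' i ≤ k} :=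
    Equiv.subtypeEquivRight fun i => by simp [zpow_ne_zero _ ht]
  rwa [Fintype.card_congr e1, Fintype.card_congr e2] at hrank

theorem multiset_eq_of_countP_le {s s' : Multiset ℤ}
    (h : ∀ k : ℤ, s.countP (· ≤ k) = s'.countP (· ≤ k)) : s = s' := by
  have aux : ∀ (u : Multiset ℤ) (k : ℤ), u.countP (· ≤ k) = u.countP (· ≤ k - 1) + u.count k := by
    intro u k
    induction u using Multiset.induction_on with
    | empty => simp
    | cons a u ih =>
      simp only [Multiset.countP_cons, Multiset.count_cons, ih]
      split_ifs <;> omega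
  ext k
  have h1 := aux s k
  have h2 := aux s' k
  rw [h k, h (k - 1)] at h1
  omega

theorem countP_univ_map {ρ : Type*} [Fintype ρ] (ν : ρ → ℤ) (k : ℤ) :
    (Finset.univ.val.map ν).countP (· ≤ k) = Fintype.card {i // ν i ≤ k} := by
  rw [Multiset.countP_map, Fintype.card_subtype]
  rfl

namespace HasOrders

section

variable {ι κ ι' κ' : Type*} [Fintype ι] [Fintype κ] [Fintype ι'] [Fintype κ']
  [DecidableEq ι] [DecidableEq κ] [DecidableEq ι'] [DecidableEq κ'] {M : Matrix ι κ K}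
  {N : Matrix ι' κ' K} {s s' : Multiset ℤ}

theorem of_localEquiv (hN : HasOrders O t N s) (e : LocalEquiv O M N) : HasOrders O t M s := by
  obtain ⟨ρ, α, β, _, _, _, _, _, _, ν, hs, e'⟩ := hN
  exact ⟨ρ, α, β, _, _, _, _, _, _, ν, hs, e.trans e'⟩

theorem unique (h : IsUniformizer O t) (hs : HasOrders O t M s) (hs' : HasOrders O t M s') :
    s = s' := by
  obtain ⟨ρ, α, β, _, _, _, _, _, _, ν, rfl, e⟩ := hs
  obtain ⟨ρ', α', β', _, _, _, _, _, _, ν', rfl, e'⟩ := hs'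
  refine multiset_eq_of_countP_le fun k => ?_
  rw [countP_univ_map, countP_univ_map]
  exact le_antisymm ((e'.symm.trans e).card_le h k) ((e.symm.trans e').card_le h k)

theorem card_eq_rank (h : IsUniformizer O t) (hs : HasOrders O t M s) :
    Multiset.card s = M.rank := by
  classical
  obtain ⟨ρ, α, β, _, _, _, _, _, _, ν, rfl, e⟩ := hs
  rw [e.rank_eq, rank_fromBlocks_zero, rank_diagonal, Multiset.card_map]
  rw [Fintype.card_congr (Equiv.subtypeUnivEquiv fun i => zpow_ne_zero (ν i) h.ne_zero)]
  rfl

theorem nonneg (h : IsUniformizer O t) (hs : HasOrders O t M s) (hM : IntegralMatrix O M) :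
    ∀ k ∈ s, 0 ≤ k := by
  obtain ⟨ρ, α, β, _, _, _, _, _, _, ν, rfl, e⟩ := hs
  intro k hk
  obtain ⟨i, -, rfl⟩ := Multiset.mem_map.1 hk
  have := e.integral hM (Sum.inl i) (Sum.inl i)
  rw [fromBlocks_apply₁₁, diagonal_apply_eq] at this
  exact h.zpow_mem.1 this

theorem smul_zpow (h : IsUniformizer O t) (hs : HasOrders O t M s) (d : ℤ) :
    HasOrders O t (t ^ d • M) (s.map fun k => k + d) := by
  obtain ⟨ρ, α, β, _, _, _, _, _, _, ν, rfl, e⟩ := hs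
  refine ⟨ρ, α, β, inferInstance, inferInstance, inferInstance, inferInstance, inferInstance,
    inferInstance, fun i => ν i + d, by simp, ?_⟩
  convert e.smul (t ^ d) using 1
  rw [fromBlocks_smul, ← diagonal_smul]
  simp only [smul_zero]
  congr 2
  ext i
  simp [zpow_add₀ h.ne_zero, mul_comm]

end

section

theorem zero {ι κ : Type} [Fintype ι] [Fintype κ] [DecidableEq ι] [DecidableEq κ] :
    HasOrders O t (0 : Matrix ι κ K) 0 := by
  refine ⟨Empty, ι, κ, inferInstance, inferInstance, inferInstance, inferInstance, inferInstance,
    inferInstance, Empty.elim, by simp, ?_⟩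
  convert LocalEquiv.submatrix (0 : Matrix ι κ K) (Equiv.emptySum Empty ι) (Equiv.emptySum Empty κ)
  ext (i | i) (j | j)
  · exact i.elim
  · exact i.elim
  · exact j.elim
  · rfl

theorem diagonal {ρ : Type} [Fintype ρ] [DecidableEq ρ] (ν : ρ → ℤ) :
    HasOrders O t (Matrix.diagonal fun i => t ^ ν i) (Finset.univ.val.map ν) := by
  refine ⟨ρ, Empty, Empty, inferInstance, inferInstance, inferInstance, inferInstance,
    inferInstance, inferInstance, ν, rfl, ?_⟩
  convert LocalEquiv.submatrix (Matrix.diagonal fun i => t ^ ν i) (Equiv.sumEmpty ρ Empty)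
    (Equiv.sumEmpty ρ Empty)
  ext (i | i) (j | j)
  · simp
  · exact j.elim
  · exact i.elim
  · exact i.elim

theorem one {ρ : Type} [Fintype ρ] [DecidableEq ρ] :
    HasOrders O t (1 : Matrix ρ ρ K) (Multiset.replicate (Fintype.card ρ) 0) := by
  convert HasOrders.diagonal (O := O) (t := t) (fun _ : ρ => 0)
  · simp
  · simp

variable {ι κ ι' κ' : Type*} [Fintype ι] [Fintype κ] [Fintype ι'] [Fintype κ']
  [DecidableEq ι] [DecidableEq κ] [DecidableEq ι'] [DecidableEq κ'] {M : Matrix ι κ K}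
  {N : Matrix ι' κ' K} {s s' : Multiset ℤ}

theorem fromBlocks (hM : HasOrders O t M s) (hN : HasOrders O t N s') :
    HasOrders O t (Matrix.fromBlocks M 0 0 N) (s + s') := by
  obtain ⟨ρ, α, β, _, _, _, _, _, _, ν, rfl, e⟩ := hM
  obtain ⟨ρ', α', β', _, _, _, _, _, _, ν', rfl, e'⟩ := hN
  refine ⟨ρ ⊕ ρ', α ⊕ α', β ⊕ β', inferInstance, inferInstance, inferInstance, inferInstance,
    inferInstance, inferInstance, Sum.elim ν ν', ?_, ?_⟩
  · rw [← Finset.univ_disjSum_univ]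
    simp [Finset.disjSum, Multiset.disjSum]
  · refine (e.fromBlocks e').trans ?_
    convert LocalEquiv.submatrix _ (Equiv.sumSumSumComm ρ ρ' α α') (Equiv.sumSumSumComm ρ ρ' β β')
    ext ((i | i) | (i | i)) ((j | j) | (j | j)) <;>
      simp [Matrix.diagonal_apply, Equiv.sumSumSumComm]

end

/-- A nonzero matrix has an entry that divides all others over `O`. -/
theorem exists_zpow_mul {O : Subring K} {t : K} (h : IsUniformizer O t) {ι κ : Type*} [Finite ι]
    [Finite κ] {M : Matrix ι κ K} (hM : M ≠ 0) :
    ∃ (i : ι) (j : κ) (k : ℤ) (u : K), u ∈ O ∧ u⁻¹ ∈ O ∧ M i j = t ^ k * u ∧ M i j ≠ 0 ∧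
      ∀ i' j', M i' j' * (M i j)⁻¹ ∈ O := by
  have hex : ∀ x : K, ∃ (k : ℤ) (u : K), x ≠ 0 → u ∈ O ∧ u⁻¹ ∈ O ∧ x = t ^ k * u := by
    intro x
    by_cases hx : x = 0
    · exact ⟨0, 0, fun h => (h hx).elim⟩
    · obtain ⟨k, u, hu⟩ := h.exists_zpow x hx
      exact ⟨k, u, fun _ => hu⟩
  choose v u huv using hex
  obtain ⟨i₀, j₀, h₀⟩ : ∃ i j, M i j ≠ 0 := by
    by_contra! hc
    exact hM (by ext i j; exact hc i j)
  obtain ⟨⟨i, j⟩, hij, hmin⟩ := Set.exists_min_image {q : ι × κ | M q.1 q.2 ≠ 0}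
    (fun q => v (M q.1 q.2)) (Set.toFinite _) ⟨(i₀, j₀), h₀⟩
  have hij : M i j ≠ 0 := hij
  obtain ⟨h1, h2, h3⟩ := huv _ hij
  refine ⟨i, j, _, _, h1, h2, h3, hij, fun i' j' => ?_⟩
  by_cases hz : M i' j' = 0
  · rw [hz, zero_mul]; exact O.zero_mem
  · obtain ⟨g1, g2, g3⟩ := huv _ hz
    have hle : v (M i j) ≤ v (M i' j') := hmin (i', j') hz
    have : M i' j' * (M i j)⁻¹ = t ^ (v (M i' j') - v (M i j)) * (u (M i' j') * (u (M i j))⁻¹) := by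
      conv_lhs => rw [g3, h3]
      rw [mul_inv, zpow_sub₀ h.ne_zero]
      ring
    rw [this]
    exact O.mul_mem (h.zpow_mem.2 (by omega)) (O.mul_mem g1 h2)

/-- Existence of the local Smith-McMillan form, by induction on the number of rows: an entry of
least order is moved to the top left corner, and its row and column are cleared. -/
theorem exists_hasOrders (h : IsUniformizer O t) {ι κ : Type} [Fintype ι] [Fintype κ]
    [DecidableEq ι] [DecidableEq κ] (M : Matrix ι κ K) : ∃ s, HasOrders O t M s := by
  induction hn : Fintype.card ι using Nat.strong_induction_on generalizing ι κ with
  | _ n ih =>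
  subst hn
  by_cases hM : M = 0
  · subst hM; exact ⟨0, .zero⟩
  obtain ⟨i, j, k, u, hu, hui, hx, hx0, hmin⟩ := exists_zpow_mul h hM
  set x := M i j with hxdef
  set e := Equiv.sumCompl (· = i) with he
  set f := Equiv.sumCompl (· = j) with hf
  set M' := M.submatrix e f with hM'
  set Y : Matrix {b // b = j} {b // ¬ b = j} K := Matrix.of fun _ b => M i b * x⁻¹ with hY
  set X : Matrix {a // ¬ a = i} {a // a = i} K := Matrix.of fun a _ => M a j * x⁻¹ with hX
  have hYint : IntegralMatrix O Y := fun _ b => hmin _ _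
  have hXint : IntegralMatrix O X := fun _ b => hmin _ _
  have hi : ∀ a : {a // a = i}, (a : ι) = i := fun a => a.2
  have hj : ∀ b : {b // b = j}, (b : κ) = j := fun b => b.2
  have hblocks : M' = Matrix.fromBlocks M'.toBlocks₁₁ (M'.toBlocks₁₁ * Y) (X * M'.toBlocks₁₁)
      M'.toBlocks₂₂ := by
    conv_lhs => rw [← fromBlocks_toBlocks M']
    congr 1
    · ext a b
      simp [hM', toBlocks₁₂, toBlocks₁₁, Matrix.mul_apply, he, hf, hY, hi, hj, ← hxdef]
      field_simp
    · ext a b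
      simp [hM', toBlocks₂₁, toBlocks₁₁, Matrix.mul_apply, he, hf, hX, hi, hj, ← hxdef]
      field_simp
  have hlt : Fintype.card {a // ¬ a = i} < Fintype.card ι :=
    Fintype.card_subtype_lt (x := i) (by simp)
  obtain ⟨s, hs⟩ := ih _ hlt (M'.toBlocks₂₂ - X * M'.toBlocks₁₁ * Y) rfl
  have hu0 : u ≠ 0 := by rintro rfl; exact hx0 (by rw [hx, mul_zero])
  have h1 : HasOrders O t M'.toBlocks₁₁ {k} := by
    have := HasOrders.diagonal (O := O) (t := t) (fun _ : Unit => k)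
    refine HasOrders.of_localEquiv (by simpa using this) ?_
    refine ⟨Matrix.of fun _ _ => u⁻¹, Matrix.of fun _ _ => u, Matrix.of fun _ _ => 1,
      Matrix.of fun _ _ => 1, ⟨fun _ _ => hui, fun _ _ => hu, ?_, ?_⟩,
      ⟨fun _ _ => O.one_mem, fun _ _ => O.one_mem, ?_, ?_⟩, ?_⟩
    · ext a b; simp [Matrix.mul_apply, hu0]
    · ext ⟨a, rfl⟩ ⟨b, rfl⟩; simp [Matrix.mul_apply, hu0]
    · ext ⟨a, rfl⟩ ⟨b, rfl⟩; simp [Matrix.mul_apply]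
    · ext a b; simp [Matrix.mul_apply]
    · ext a b
      simp [Matrix.mul_apply, hM', toBlocks₁₁, he, hf, hi, hj, ← hxdef, hx]
      field_simp
  refine ⟨{k} + s, (h1.fromBlocks hs).of_localEquiv ?_⟩
  refine (LocalEquiv.submatrix M e f).trans ?_
  rw [← hM', hblocks]
  exact LocalEquiv.eliminate _ _ hXint hYint

end HasOrders

end Orders

/-! ### System matrices and their transfer functions -/

section Transfer

variable {K : Type*} [Field K] {O : Subring K} {t : K}

/-- Padding with a zero block does not change the orders. -/
theorem HasOrders.of_fromBlocks_zero (h : IsUniformizer O t) {ι κ α β : Type} [Fintype ι]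
    [Fintype κ] [Fintype α] [Fintype β] [DecidableEq ι] [DecidableEq κ] [DecidableEq α]
    [DecidableEq β] {M : Matrix ι κ K} {s : Multiset ℤ}
    (hM : HasOrders O t (Matrix.fromBlocks M 0 0 (0 : Matrix α β K)) s) : HasOrders O t M s := by
  obtain ⟨s', hs'⟩ := HasOrders.exists_hasOrders h M
  rwa [hM.unique h (hs'.fromBlocks HasOrders.zero), add_zero]

/-- A nonsingular matrix over `O` is equivalent to `1 ⊕ diag(t ^ ε)` with all `ε i > 0`. -/
theorem exists_localEquiv_one_fromBlocks (h : IsUniformizer O t) {σ : Type} [Fintype σ]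
    [DecidableEq σ] {A Ai : Matrix σ σ K} (hA : IntegralMatrix O A) (hAi : A * Ai = 1) :
    ∃ (σ₀ σ₁ : Type) (_ : Fintype σ₀) (_ : Fintype σ₁) (_ : DecidableEq σ₀) (_ : DecidableEq σ₁)
      (ε : σ₁ → ℤ), (∀ i, 0 < ε i) ∧
      LocalEquiv O A (Matrix.fromBlocks (1 : Matrix σ₀ σ₀ K) 0 0 (diagonal fun i => t ^ ε i)) := by
  obtain ⟨s, hs⟩ := HasOrders.exists_hasOrders h A
  have hcard := hs.card_eq_rank h
  have hnn := hs.nonneg h hA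
  obtain ⟨ρ, α, β, _, _, _, _, _, _, ν, rfl, e⟩ := hs
  rw [rank_of_isUnit _ (IsUnit.of_mul_eq_one Ai hAi)] at hcard
  simp only [Multiset.card_map, Finset.card_val, Finset.card_univ] at hcard
  obtain ⟨hα, hβ⟩ := e.card_eq
  rw [Fintype.card_sum] at hα hβ
  have : IsEmpty α := Fintype.card_eq_zero_iff.1 (by omega)
  have : IsEmpty β := Fintype.card_eq_zero_iff.1 (by omega)
  refine ⟨{i // ν i = 0}, {i // ¬ ν i = 0}, inferInstance, inferInstance, inferInstance,
    inferInstance, fun i => ν i, fun i => ?_, e.trans ?_⟩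
  · have := hnn (ν i) (Multiset.mem_map_of_mem _ (Finset.mem_univ_val _))
    exact lt_of_le_of_ne this (Ne.symm i.2)
  · convert LocalEquiv.submatrix _
      ((Equiv.sumCompl (fun i : ρ => ν i = 0)).trans (Equiv.sumEmpty ρ α).symm)
      ((Equiv.sumCompl (fun i : ρ => ν i = 0)).trans (Equiv.sumEmpty ρ β).symm)
    ext (i | i) (j | j)
    · by_cases hij : i = j
      · subst hij; simp [i.2]
      · simp [hij, Subtype.coe_injective.ne hij]
    · have : (i : ρ) ≠ j := fun hij => j.2 (hij ▸ i.2)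
      simp [this]
    · have : (i : ρ) ≠ j := fun hij => i.2 (hij ▸ j.2)
      simp [this]
    · by_cases hij : i = j
      · subst hij; simp
      · simp [hij, Subtype.coe_injective.ne hij]

section

variable {σ π μ : Type} [Fintype σ] [Fintype π] [Fintype μ] [DecidableEq σ] [DecidableEq π]
  [DecidableEq μ]

/-- The key step, for a state matrix `E` that vanishes modulo `t`: after padding with zeros, the
system matrix is equivalent to `1 ⊕ 1 ⊕ T` and its transfer function to `E⁻¹ ⊕ T`, for one matrix `T`
over `O`. -/
theorem exists_localEquiv_system (h : IsUniformizer O t) {E E' Ei X X' : Matrix σ σ K}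
    {B : Matrix σ μ K} {C : Matrix π σ K} {D : Matrix π μ K} {Y : Matrix σ π K} {Y' : Matrix μ σ K}
    (hE' : IntegralMatrix O E') (hB : IntegralMatrix O B) (hC : IntegralMatrix O C)
    (hD : IntegralMatrix O D) (hX : IntegralMatrix O X) (hX' : IntegralMatrix O X')
    (hY : IntegralMatrix O Y) (hY' : IntegralMatrix O Y') (hE : E = t • E') (hEi : Ei * E = 1)
    (hXY : X * E + Y * C = 1) (hXY' : E * X' + B * Y' = 1) :
    ∃ T : Matrix π μ K, IntegralMatrix O T ∧
      LocalEquiv O (Matrix.fromBlocks (Matrix.fromBlocks E B (-C) D) 0 0 (0 : Matrix σ σ K))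
        (Matrix.fromBlocks (1 : Matrix σ σ K) 0 0 (Matrix.fromBlocks (1 : Matrix σ σ K) 0 0 T)) ∧
      LocalEquiv O (Matrix.fromBlocks (D + C * Ei * B) 0 0 (0 : Matrix σ σ K))
        (Matrix.fromBlocks Ei 0 0 T) := by
  have hEi' : E * Ei = 1 := mul_eq_one_comm.1 hEi
  have hEint : IntegralMatrix O E := hE ▸ hE'.smul h.mem
  set J : Matrix σ μ K := X * B - Y * D with hJ
  set H : Matrix π σ K := D * Y' - C * X' with hH
  set S : Matrix σ σ K := X' + J * Y' with hS
  have hJint : IntegralMatrix O J := (hX.mul hB).sub (hY.mul hD)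
  have hHint : IntegralMatrix O H := (hD.mul hY').sub (hC.mul hX')
  have hSint : IntegralMatrix O S := hX'.add (hJint.mul hY')
  obtain ⟨V, hV⟩ := h.exists_integralInverse_one_sub (hSint.mul hE')
  obtain ⟨V₂, hV₂⟩ := h.exists_integralInverse_one_sub (hE'.mul hSint)
  rw [← Matrix.mul_smul, ← hE] at hV
  rw [← Matrix.smul_mul, ← hE] at hV₂
  refine ⟨D - H * B + (C + H * E) * V * (J - S * B), ?_, ?_, ?_⟩
  · exact (hD.sub (hHint.mul hB)).add
      (((hC.add (hHint.mul hEint)).mul hV.integral_inv).mul (hJint.sub (hSint.mul hB)))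
  · -- Bézout fills the padding: add `X` times the first block row minus `Y` times the second, and
    -- `X'`, `Y'` times the block columns
    have e1 : LocalEquiv O
        (Matrix.fromBlocks (Matrix.fromBlocks E B (-C) D) 0 0 (0 : Matrix σ σ K))
        (Matrix.fromBlocks (Matrix.fromBlocks E B (-C) D) (Matrix.fromRows 1 H)
          (Matrix.fromCols 1 J) S) := by
      refine ⟨_, _, _, _, .lower (X := Matrix.fromCols X (-Y)) (hX.fromCols hY.neg),
        .upper (X := Matrix.fromRows X' Y') (hX'.fromRows hY'), ?_⟩
      have a1 : Matrix.fromCols X (-Y) * Matrix.fromBlocks E B (-C) D = Matrix.fromCols 1 J := by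
        rw [fromCols_mul_fromBlocks, ← hXY, hJ]
        simp [sub_eq_add_neg]
      have a2 : Matrix.fromBlocks E B (-C) D * Matrix.fromRows X' Y' = Matrix.fromRows 1 H := by
        rw [fromBlocks_mul_fromRows, hXY', hH]
        congr 1
        rw [Matrix.neg_mul]; abel
      rw [fromBlocks_multiply, fromBlocks_multiply]
      simp only [Matrix.one_mul, Matrix.mul_zero, Matrix.mul_one, add_zero, a1, a2]
      rw [fromCols_mul_fromRows, Matrix.one_mul]
    refine e1.trans ?_
    -- move the identity blocks to the top left corner and eliminate with them
    refine (LocalEquiv.submatrix _ (((Equiv.refl σ).sumCongr (Equiv.sumComm σ π)).trans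
      (Equiv.sumAssoc σ π σ).symm) (Equiv.sumComm σ (σ ⊕ μ))).trans ?_
    have e2 := LocalEquiv.eliminate (O := O) (1 : Matrix σ σ K)
      (Matrix.fromBlocks 1 J (-C) D) (X := Matrix.fromRows S H) (Y := Matrix.fromCols E B)
      (hSint.fromRows hHint) (hEint.fromCols hB)
    have a3 : Matrix.fromBlocks (1 : Matrix σ σ K) J (-C) D -
        Matrix.fromRows S H * (1 : Matrix σ σ K) * Matrix.fromCols E B =
        Matrix.fromBlocks (1 - S * E) (J - S * B) (-C - H * E) (D - H * B) := by
      rw [Matrix.mul_one, fromRows_mul_fromCols, sub_eq_add_neg, fromBlocks_neg, fromBlocks_add]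
      simp only [sub_eq_add_neg]
    rw [a3] at e2
    have e3 := LocalEquiv.eliminate (O := O) (1 - S * E) (D - H * B)
      (X := (-C - H * E) * V) (Y := V * (J - S * B))
      ((hC.neg.sub (hHint.mul hEint)).mul hV.integral_inv)
      (hV.integral_inv.mul (hJint.sub (hSint.mul hB)))
    have a4 : D - H * B - (-C - H * E) * (V * (J - S * B)) =
        D - H * B + (C + H * E) * V * (J - S * B) := by
      rw [← Matrix.mul_assoc, show -C - H * E = -(C + H * E) by abel]
      simp only [Matrix.neg_mul, sub_neg_eq_add]
    rw [← Matrix.mul_assoc (1 - S * E), hV.mul_inv, Matrix.one_mul,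
      Matrix.mul_assoc (-C - H * E), hV.inv_mul, Matrix.mul_one, a4] at e3
    have e4 : LocalEquiv O (1 - S * E) (1 : Matrix σ σ K) := by
      have := LocalEquiv.mul_left hV.symm (1 - S * E)
      rwa [hV.inv_mul] at this
    have e5 := e2.trans ((LocalEquiv.refl (1 : Matrix σ σ K)).fromBlocks
      (e3.trans (e4.fromBlocks (LocalEquiv.refl _))))
    convert e5 using 1
    ext (i | i | i) (j | j | j) <;> simp
  · -- the same operations on `G ⊕ 0`; those that involve the state variables leave it fixed
    have e1 : LocalEquiv O (Matrix.fromBlocks (D + C * Ei * B) 0 0 (0 : Matrix σ σ K))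
        (Matrix.fromBlocks (D + C * Ei * B) (H + C * Ei) (J - Ei * B) (S - Ei)) := by
      refine ⟨_, _, _, _, .lower hY.neg, .upper hY', ?_⟩
      have b1 : -Y * (D + C * Ei * B) = J - Ei * B := by
        rw [hJ, Matrix.neg_mul, Matrix.mul_add, ← Matrix.mul_assoc, ← Matrix.mul_assoc,
          eq_sub_of_add_eq' hXY, Matrix.sub_mul, Matrix.one_mul, Matrix.mul_assoc X, hEi',
          Matrix.mul_one, Matrix.sub_mul]
        abel
      have b2 : (D + C * Ei * B) * Y' = H + C * Ei := by
        rw [hH, Matrix.add_mul, Matrix.mul_assoc (C * Ei), eq_sub_of_add_eq' hXY', Matrix.mul_sub,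
          Matrix.mul_one, Matrix.mul_assoc C, ← Matrix.mul_assoc Ei, hEi, Matrix.one_mul]
        abel
      have b3 : (J - Ei * B) * Y' = S - Ei := by
        rw [hS, Matrix.sub_mul, Matrix.mul_assoc Ei, eq_sub_of_add_eq' hXY', Matrix.mul_sub,
          Matrix.mul_one, ← Matrix.mul_assoc Ei, hEi, Matrix.one_mul]
        abel
      rw [fromBlocks_multiply, fromBlocks_multiply]
      simp only [Matrix.one_mul, Matrix.mul_zero, Matrix.mul_one, add_zero, b1, b2, b3]
    refine (e1.trans (LocalEquiv.submatrix _ (Equiv.sumComm σ π) (Equiv.sumComm σ μ))).trans ?_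
    -- the pivot `S - E⁻¹` divides its row and its column over `O`, and it is a unit times `E⁻¹`
    have c1 : S - Ei = -((1 - S * E) * Ei) := by
      rw [Matrix.sub_mul, Matrix.one_mul, Matrix.mul_assoc, hEi', Matrix.mul_one]; abel
    have c2 : S - Ei = -(Ei * (1 - E * S)) := by
      rw [Matrix.mul_sub, Matrix.mul_one, ← Matrix.mul_assoc, hEi, Matrix.one_mul]; abel
    have c3 : (S - Ei) * -(V₂ * (E * J - B)) = J - Ei * B := by
      rw [c2, Matrix.neg_mul, Matrix.mul_neg, neg_neg, Matrix.mul_assoc,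
        ← Matrix.mul_assoc _ V₂, hV₂.mul_inv, Matrix.one_mul, Matrix.mul_sub,
        ← Matrix.mul_assoc, hEi, Matrix.one_mul]
    have c4 : -((C + H * E) * V) * (S - Ei) = H + C * Ei := by
      rw [c1, Matrix.neg_mul, Matrix.mul_neg, neg_neg, Matrix.mul_assoc,
        ← Matrix.mul_assoc V, hV.inv_mul, Matrix.one_mul, Matrix.add_mul,
        Matrix.mul_assoc H, hEi', Matrix.mul_one, add_comm]
    have e2 := LocalEquiv.eliminate (O := O) (S - Ei) (D + C * Ei * B)
      (X := -((C + H * E) * V)) (Y := -(V₂ * (E * J - B)))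
      ((hC.add (hHint.mul hEint)).mul hV.integral_inv).neg
      (hV₂.integral_inv.mul ((hEint.mul hJint).sub hB)).neg
    rw [c3, c4] at e2
    have c5 : (D + C * Ei * B) - (H + C * Ei) * -(V₂ * (E * J - B)) =
        D - H * B + (C + H * E) * V * (J - S * B) := by
      have c6 : (C + H * E) * V * ((S - Ei) * B) = -((H + C * Ei) * B) := by
        rw [← Matrix.mul_assoc, ← c4, Matrix.neg_mul, Matrix.neg_mul, neg_neg]
      rw [← c4, Matrix.mul_assoc (-((C + H * E) * V)), c3, Matrix.neg_mul, sub_neg_eq_add]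
      have c7 : J - Ei * B = (J - S * B) + (S - Ei) * B := by
        rw [Matrix.sub_mul]; abel
      rw [c7, Matrix.mul_add, c6, Matrix.add_mul H (C * Ei) B]
      abel
    rw [c5] at e2
    have hneg : IsIntegralInverse O (-V) (-(1 - S * E)) :=
      ⟨hV.integral_inv.neg, hV.integral.neg, by
        rw [Matrix.neg_mul, Matrix.mul_neg, neg_neg, hV.inv_mul], by
        rw [Matrix.neg_mul, Matrix.mul_neg, neg_neg, hV.mul_inv]⟩
    have e3 := LocalEquiv.mul_left hneg (S - Ei)
    rw [show -V * (S - Ei) = Ei by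
      rw [c1, Matrix.neg_mul, Matrix.mul_neg, neg_neg, ← Matrix.mul_assoc, hV.inv_mul,
        Matrix.one_mul]] at e3
    have e4 := e2.trans (e3.fromBlocks (LocalEquiv.refl _))
    convert e4 using 1
    ext (i | i) (j | j) <;> simp

end

end Transfer

section Transfer

variable {K : Type*} [Field K] {O : Subring K} {t : K}
variable {σ₀ σ π μ : Type} [Fintype σ₀] [Fintype σ] [Fintype π] [Fintype μ]
  [DecidableEq σ₀] [DecidableEq σ] [DecidableEq π] [DecidableEq μ]

/-- The orders of a system matrix and of its transfer function, when the state matrix is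
`diag(t ^ ε)` with all `ε i > 0`. -/
theorem exists_orders_of_diagonal (h : IsUniformizer O t) {ε : σ → ℤ} (hε : ∀ i, 0 < ε i)
    {X X' : Matrix σ σ K} {B : Matrix σ μ K} {C : Matrix π σ K} {D : Matrix π μ K}
    {Y : Matrix σ π K} {Y' : Matrix μ σ K}
    (hB : IntegralMatrix O B) (hC : IntegralMatrix O C) (hD : IntegralMatrix O D)
    (hX : IntegralMatrix O X) (hX' : IntegralMatrix O X') (hY : IntegralMatrix O Y)
    (hY' : IntegralMatrix O Y')
    (hXY : X * (diagonal fun i => t ^ ε i) + Y * C = 1)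
    (hXY' : (diagonal fun i => t ^ ε i) * X' + B * Y' = 1) :
    ∃ (w : Multiset ℤ) (b : ℕ), (∀ k ∈ w, 0 ≤ k) ∧
      HasOrders O t (Matrix.fromBlocks (diagonal fun i => t ^ ε i) B (-C) D)
        (Multiset.replicate b 0 + w) ∧
      HasOrders O t (D + C * (diagonal fun i => t ^ (-ε i)) * B)
        (Finset.univ.val.map (fun i => -ε i) + w) := by
  have hE : (diagonal fun i => t ^ ε i) = t • diagonal fun i => t ^ (ε i - 1) := by
    rw [← diagonal_smul]
    congr 1
    ext i
    simp only [Pi.smul_apply, smul_eq_mul]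
    rw [← zpow_one_add₀ h.ne_zero, add_sub_cancel]
  have hE' : IntegralMatrix O (diagonal fun i => t ^ (ε i - 1)) := by
    intro i j
    rw [diagonal_apply]
    split_ifs
    · exact h.zpow_mem.2 (by have := hε i; omega)
    · exact O.zero_mem
  have hEi : (diagonal fun i => t ^ (-ε i)) * (diagonal fun i => t ^ ε i) = 1 := by
    rw [diagonal_mul_diagonal, ← diagonal_one]
    congr 1
    ext i
    rw [← zpow_add₀ h.ne_zero, neg_add_cancel, zpow_zero]
  obtain ⟨T, hT, e1, e2⟩ :=
    exists_localEquiv_system h hE' hB hC hD hX hX' hY hY' hE hEi hXY hXY'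
  obtain ⟨w, hw⟩ := HasOrders.exists_hasOrders h T
  refine ⟨w, Fintype.card σ + Fintype.card σ, hw.nonneg h hT, ?_, ?_⟩
  · rw [Multiset.replicate_add, add_assoc]
    exact HasOrders.of_fromBlocks_zero h
      ((HasOrders.one.fromBlocks (HasOrders.one.fromBlocks hw)).of_localEquiv e1)
  · exact HasOrders.of_fromBlocks_zero h
      (((HasOrders.diagonal fun i => -ε i).fromBlocks hw).of_localEquiv e2)

/-- Elimination of a unit block of the state matrix; it adds `C₀ B₀` to the block `D`. -/
theorem localEquiv_fromBlocks_fromBlocks {E : Matrix σ σ K} {B₀ : Matrix σ₀ μ K} {B : Matrix σ μ K}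
    {C₀ : Matrix π σ₀ K} {C : Matrix π σ K} {D : Matrix π μ K}
    (hB₀ : IntegralMatrix O B₀) (hC₀ : IntegralMatrix O C₀) :
    LocalEquiv O (Matrix.fromBlocks (Matrix.fromBlocks (1 : Matrix σ₀ σ₀ K) 0 0 E)
        (Matrix.fromRows B₀ B) (-Matrix.fromCols C₀ C) D)
      (Matrix.fromBlocks (1 : Matrix σ₀ σ₀ K) 0 0
        (Matrix.fromBlocks E B (-C) (D + C₀ * B₀))) := by
  have e1 := LocalEquiv.submatrix (O := O)
    (Matrix.fromBlocks (Matrix.fromBlocks (1 : Matrix σ₀ σ₀ K) 0 0 E)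
        (Matrix.fromRows B₀ B) (-Matrix.fromCols C₀ C) D)
    (Equiv.sumAssoc σ₀ σ π).symm (Equiv.sumAssoc σ₀ σ μ).symm
  have e2 := LocalEquiv.eliminate (O := O) (1 : Matrix σ₀ σ₀ K) (Matrix.fromBlocks E B (-C) D)
    (X := Matrix.fromRows (0 : Matrix σ σ₀ K) (-C₀))
    (Y := Matrix.fromCols (0 : Matrix σ₀ σ K) B₀)
    (IntegralMatrix.zero.fromRows hC₀.neg) (IntegralMatrix.zero.fromCols hB₀)
  refine e1.trans ?_
  convert e2 using 1
  · ext (i | i | i) (j | j | j) <;> simp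
  · congr 1
    rw [Matrix.mul_one, fromRows_mul_fromCols, sub_eq_add_neg, fromBlocks_neg, fromBlocks_add]
    simp

/-- The orders of a minimal system matrix over `O` and of its transfer function: the zeros `w` come
from the system matrix and the poles `e` from the state matrix. -/
theorem exists_orders_system (h : IsUniformizer O t) {A Ai X X' : Matrix σ σ K}
    {B : Matrix σ μ K} {C : Matrix π σ K} {D : Matrix π μ K} {Y : Matrix σ π K} {Y' : Matrix μ σ K}
    (hA : IntegralMatrix O A)
    (hB : IntegralMatrix O B) (hC : IntegralMatrix O C) (hD : IntegralMatrix O D)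
    (hX : IntegralMatrix O X) (hX' : IntegralMatrix O X') (hY : IntegralMatrix O Y)
    (hY' : IntegralMatrix O Y') (hAi : A * Ai = 1)
    (hXY : X * A + Y * C = 1) (hXY' : A * X' + B * Y' = 1) :
    ∃ (w e : Multiset ℤ) (a b : ℕ), (∀ k ∈ w, 0 ≤ k) ∧ (∀ k ∈ e, 0 < k) ∧
      HasOrders O t A (Multiset.replicate a 0 + e) ∧
      HasOrders O t (Matrix.fromBlocks A B (-C) D) (Multiset.replicate b 0 + w) ∧
      HasOrders O t (D + C * Ai * B) (e.map (fun k => -k) + w) := by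
  obtain ⟨σ₀, σ₁, _, _, _, _, ε, hε, U, U', V, V', hU, hV, hUV⟩ :=
    exists_localEquiv_one_fromBlocks h hA hAi
  set E : Matrix σ₁ σ₁ K := diagonal fun i => t ^ ε i with hE
  -- the blocks and the Bézout coefficients of the system transformed by `U` and `V`
  set B₂ := U * B with hB₂
  set C₂ := C * V with hC₂
  have hB₂i : IntegralMatrix O B₂ := hU.integral.mul hB
  have hC₂i : IntegralMatrix O C₂ := hC.mul hV.integral
  set X₂ := V' * X * U' with hX₂
  set Y₂ := V' * Y with hY₂
  set X₃ := V' * X' * U' with hX₃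
  set Y₃ := Y' * U' with hY₃
  have hX₂i : IntegralMatrix O X₂ := (hV.integral_inv.mul hX).mul hU.integral_inv
  have hX₃i : IntegralMatrix O X₃ := (hV.integral_inv.mul hX').mul hU.integral_inv
  have hY₂i : IntegralMatrix O Y₂ := hV.integral_inv.mul hY
  have hY₃i : IntegralMatrix O Y₃ := hY'.mul hU.integral_inv
  have k2 : X₂ * Matrix.fromBlocks 1 0 0 E + Y₂ * C₂ = 1 := by
    calc _ = V' * (X * ((U' * U) * A) + Y * C) * V := by
          rw [← hUV, hX₂, hY₂, hC₂]
          simp only [Matrix.mul_add, Matrix.add_mul, Matrix.mul_assoc]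
      _ = 1 := by rw [hU.inv_mul, Matrix.one_mul, hXY, Matrix.mul_one, hV.inv_mul]
  have k3 : Matrix.fromBlocks 1 0 0 E * X₃ + B₂ * Y₃ = 1 := by
    calc _ = U * (A * ((V * V') * X') + B * Y') * U' := by
          rw [← hUV, hX₃, hY₃, hB₂]
          simp only [Matrix.mul_add, Matrix.add_mul, Matrix.mul_assoc]
      _ = 1 := by rw [hV.mul_inv, Matrix.one_mul, hXY', Matrix.mul_one, hU.mul_inv]
  have hinv : Matrix.fromBlocks (1 : Matrix σ₀ σ₀ K) 0 0 (diagonal fun i => t ^ (-ε i)) =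
      V' * Ai * U' := by
    have h1 : Matrix.fromBlocks (1 : Matrix σ₀ σ₀ K) 0 0 (diagonal fun i => t ^ (-ε i)) *
        Matrix.fromBlocks 1 0 0 E = 1 := by
      rw [fromBlocks_multiply, hE, diagonal_mul_diagonal]
      simp [inv_mul_cancel₀ (zpow_ne_zero _ h.ne_zero)]
    have h2 : Matrix.fromBlocks (1 : Matrix σ₀ σ₀ K) 0 0 E * (V' * Ai * U') = 1 := by
      calc _ = U * (A * ((V * V') * Ai)) * U' := by
            rw [← hUV]; simp only [Matrix.mul_assoc]
        _ = 1 := by rw [hV.mul_inv, Matrix.one_mul, hAi, Matrix.mul_one, hU.mul_inv]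
    exact left_inv_eq_right_inv h1 h2
  have hP : LocalEquiv O (Matrix.fromBlocks A B (-C) D)
      (Matrix.fromBlocks (Matrix.fromBlocks 1 0 0 E) B₂ (-C₂) D) := by
    refine ⟨_, _, _, _, hU.fromBlocks .one, hV.fromBlocks .one, ?_⟩
    rw [fromBlocks_multiply, fromBlocks_multiply, ← hUV]
    simp [hB₂, hC₂]
  have hG : D + C * Ai * B = D + C₂ *
      Matrix.fromBlocks (1 : Matrix σ₀ σ₀ K) 0 0 (diagonal fun i => t ^ (-ε i)) * B₂ := by
    rw [hinv, hC₂, hB₂]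
    calc _ = D + C * ((V * V') * Ai * (U' * U)) * B := by
          rw [hV.mul_inv, hU.inv_mul, Matrix.one_mul, Matrix.mul_one]
      _ = _ := by simp only [Matrix.mul_assoc]
  rw [← fromRows_toRows B₂, ← fromCols_toCols C₂] at hP hG
  have k2' : X₂.toBlocks₂₂ * E + Y₂.toRows₂ * C₂.toCols₂ = 1 := by
    have := congrArg toBlocks₂₂ k2
    rw [← fromBlocks_toBlocks X₂, fromBlocks_multiply] at this
    rw [← fromRows_toRows Y₂, ← fromCols_toCols C₂, fromRows_mul_fromCols, fromBlocks_add] at this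
    simpa [← fromBlocks_one] using this
  have k3' : E * X₃.toBlocks₂₂ + B₂.toRows₂ * Y₃.toCols₂ = 1 := by
    have := congrArg toBlocks₂₂ k3
    rw [← fromBlocks_toBlocks X₃, fromBlocks_multiply] at this
    rw [← fromRows_toRows B₂, ← fromCols_toCols Y₃, fromRows_mul_fromCols, fromBlocks_add] at this
    simpa [← fromBlocks_one] using this
  have iB₀ : IntegralMatrix O B₂.toRows₁ := fun _ _ => hB₂i _ _
  have iC₀ : IntegralMatrix O C₂.toCols₁ := fun _ _ => hC₂i _ _
  obtain ⟨w, b, hw, hPo, hGo⟩ := exists_orders_of_diagonal h hε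
    (B := B₂.toRows₂) (C := C₂.toCols₂) (D := D + C₂.toCols₁ * B₂.toRows₁)
    (X := X₂.toBlocks₂₂) (X' := X₃.toBlocks₂₂) (Y := Y₂.toRows₂) (Y' := Y₃.toCols₂)
    (fun _ _ => hB₂i _ _) (fun _ _ => hC₂i _ _) (hD.add (iC₀.mul iB₀)) (fun _ _ => hX₂i _ _)
    (fun _ _ => hX₃i _ _) (fun _ _ => hY₂i _ _) (fun _ _ => hY₃i _ _) k2' k3'
  refine ⟨w, Finset.univ.val.map ε, Fintype.card σ₀, Fintype.card σ₀ + b, hw, ?_, ?_, ?_, ?_⟩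
  · intro k hk
    obtain ⟨i, -, rfl⟩ := Multiset.mem_map.1 hk
    exact hε i
  · exact (HasOrders.one.fromBlocks (HasOrders.diagonal ε)).of_localEquiv
      ⟨U, U', V, V', hU, hV, hUV⟩
  · rw [Multiset.replicate_add, add_assoc]
    exact (HasOrders.one.fromBlocks hPo).of_localEquiv
      (hP.trans (localEquiv_fromBlocks_fromBlocks iB₀ iC₀))
  · rw [hG, fromCols_mul_fromBlocks, fromCols_mul_fromRows]
    simp only [Matrix.mul_one, Matrix.mul_zero, add_zero, zero_add, ← add_assoc]
    rw [Multiset.map_map]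
    exact hGo

end Transfer

/-! ### Comparison with the concrete definitions at a finite point -/

section SameOrders

variable {K : Type*} [Field K] {O : Subring K} {t : K}

theorem exists_equiv_comp_eq {ρ ρ' : Type*} [Fintype ρ] [Fintype ρ'] {ν : ρ → ℤ} {ν' : ρ' → ℤ}
    (h : Finset.univ.val.map ν = Finset.univ.val.map ν') : ∃ e : ρ ≃ ρ', ∀ i, ν' (e i) = ν i := by
  classical
  have hc : ∀ k, Nonempty ({i // ν i = k} ≃ {i // ν' i = k}) := by
    intro k
    have := congrArg (Multiset.count k) h
    rw [Multiset.count_map, Multiset.count_map] at this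
    refine Fintype.card_eq.1 ?_
    rw [Fintype.card_subtype, Fintype.card_subtype]
    simpa [Finset.card_def, eq_comm] using this
  exact ⟨Equiv.ofFiberEquiv fun k => (hc k).some, fun i => Equiv.ofFiberEquiv_map _ i⟩

/-- Matrices of the same shape with the same orders are equivalent. -/
theorem HasOrders.localEquiv {ι κ : Type*} [Fintype ι] [Fintype κ] [DecidableEq ι]
    [DecidableEq κ] {M N : Matrix ι κ K} {s : Multiset ℤ} (hM : HasOrders O t M s)
    (hN : HasOrders O t N s) : LocalEquiv O M N := by
  obtain ⟨ρ, α, β, _, _, _, _, _, _, ν, rfl, e⟩ := hM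
  obtain ⟨ρ', α', β', _, _, _, _, _, _, ν', hs, e'⟩ := hN
  obtain ⟨f, hf⟩ := exists_equiv_comp_eq hs
  have hρ := Fintype.card_congr f
  have h1 := e.card_eq
  have h2 := e'.card_eq
  simp only [Fintype.card_sum] at h1 h2
  obtain ⟨g⟩ : Nonempty (α ≃ α') := Fintype.card_eq.1 (by omega)
  obtain ⟨g'⟩ : Nonempty (β ≃ β') := Fintype.card_eq.1 (by omega)
  refine e.trans (LocalEquiv.trans ?_ e'.symm)
  refine LocalEquiv.symm ?_
  convert LocalEquiv.submatrix _ (f.sumCongr g) (f.sumCongr g')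
  ext (i | i) (j | j) <;> simp [Matrix.diagonal_apply, hf]

theorem diagPowers_apply {F : Type*} [Field F] {p m : ℕ} (t : RatFunc F) (ν : List ℤ) (i : Fin p)
    (j : Fin m) : diagPowers p m t ν i j =
      if h : i.val = j.val ∧ i.val < ν.length then t ^ ν[i.val] else 0 := by
  rw [diagPowers, Matrix.of_apply]
  by_cases h1 : i.val = j.val
  · by_cases h2 : i.val < ν.length
    · rw [if_pos h1, dif_pos ⟨h1, h2⟩]
      simp [List.getD_eq_getElem?_getD, h2]
    · rw [if_pos h1, dif_neg (by tauto)]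
      simp [List.getD_eq_getElem?_getD, h2]
  · rw [if_neg h1, dif_neg (by tauto)]

/-- The length bounds matter: `diagPowers` drops the powers beyond its diagonal. -/
theorem hasOrders_diagPowers {F : Type*} [Field F] {O : Subring (RatFunc F)} {t : RatFunc F}
    {p m : ℕ} {ν : List ℤ} (hp : ν.length ≤ p) (hm : ν.length ≤ m) :
    HasOrders O t (diagPowers p m t ν) ν := by
  obtain ⟨a, rfl⟩ := Nat.exists_eq_add_of_le hp
  obtain ⟨b, rfl⟩ := Nat.exists_eq_add_of_le hm
  refine ⟨Fin ν.length, Fin a, Fin b, inferInstance, inferInstance, inferInstance, inferInstance,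
    inferInstance, inferInstance, fun i => ν[i], ?_, ?_⟩
  · rw [Fin.univ_val_map]
    congr 1
    exact (List.ofFn_getElem (xs := ν)).symm
  · convert LocalEquiv.submatrix _ finSumFinEquiv finSumFinEquiv
    ext (i | i) (j | j)
    · by_cases hij : i = j
      · subst hij; simp [diagPowers_apply]
      · have : i.val ≠ j.val := fun h => hij (Fin.ext h)
        simp [diagPowers_apply, hij, this]
    · simp [diagPowers_apply]
      omega
    · simp [diagPowers_apply]
    · simp [diagPowers_apply]

end SameOrders

section Localization

variable {F : Type*} [Field F]

/-- The local ring of rational functions defined at `a`. -/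
def localSubring (a : F) : Subring (RatFunc F) where
  carrier := {f | f.denom.eval a ≠ 0}
  mul_mem' {x y} hx hy h := by
    have := Polynomial.eval_eq_zero_of_dvd_of_eval_eq_zero (RatFunc.denom_mul_dvd x y) h
    rw [Polynomial.eval_mul] at this
    exact (mul_ne_zero hx hy) this
  one_mem' := by simp
  add_mem' {x y} hx hy h := by
    have := Polynomial.eval_eq_zero_of_dvd_of_eval_eq_zero (RatFunc.denom_add_dvd x y) h
    rw [Polynomial.eval_mul] at this
    exact (mul_ne_zero hx hy) this
  zero_mem' := by simp
  neg_mem' {x} hx h := by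
    have h1 := RatFunc.denom_mul_dvd (algebraMap F[X] (RatFunc F) (-1)) x
    rw [RatFunc.denom_algebraMap, one_mul, map_neg, map_one, neg_one_mul] at h1
    exact hx (Polynomial.eval_eq_zero_of_dvd_of_eval_eq_zero h1 h)

theorem mem_localSubring {a : F} {f : RatFunc F} :
    f ∈ localSubring a ↔ f.denom.eval a ≠ 0 := Iff.rfl

theorem algebraMap_mem_localSubring (a : F) (q : F[X]) :
    algebraMap F[X] (RatFunc F) q ∈ localSubring a := by
  simp [mem_localSubring]

theorem div_mem_localSubring {a : F} (p : F[X]) {q : F[X]} (hq : q.eval a ≠ 0) :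
    algebraMap F[X] (RatFunc F) p / algebraMap F[X] (RatFunc F) q ∈ localSubring a :=
  fun h => hq (Polynomial.eval_eq_zero_of_dvd_of_eval_eq_zero (RatFunc.denom_div_dvd p q) h)

/-- Evaluation at `a`, on the rational functions defined at `a`. -/
def localEval (a : F) : localSubring a →+* F where
  toFun f := RatFunc.eval (RingHom.id F) a f
  map_one' := RatFunc.eval_one _ _
  map_zero' := RatFunc.eval_zero _ _
  map_mul' x y := RatFunc.eval_mul _ _ x.2 y.2
  map_add' x y := RatFunc.eval_add _ _ x.2 y.2

theorem inv_mem_localSubring {a : F} {f : RatFunc F}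
    (h : f.eval (RingHom.id F) a ≠ 0) : f⁻¹ ∈ localSubring a := by
  have hnum : f.num.eval a ≠ 0 := by
    intro h0
    apply h
    rw [RatFunc.eval, Polynomial.eval₂_id, h0, zero_div]
  rw [← RatFunc.num_div_denom f, inv_div]
  exact div_mem_localSubring _ hnum

theorem ratFunc_X_sub_C_ne_zero (a : F) : (RatFunc.X - RatFunc.C a : RatFunc F) ≠ 0 := by
  have := (map_ne_zero_iff (algebraMap F[X] (RatFunc F)) (RatFunc.algebraMap_injective F)).2
    (Polynomial.X_sub_C_ne_zero a)
  simpa using this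

/-- The rational functions defined at `a` form a discrete valuation ring with uniformizer
`X - a`. -/
theorem isUniformizer_localSubring (a : F) :
    IsUniformizer (localSubring a) (RatFunc.X - RatFunc.C a) where
  mem := by
    have := algebraMap_mem_localSubring a (X - C a)
    simpa using this
  inv_notMem hmem := by
    have hne := ratFunc_X_sub_C_ne_zero a
    have hX : (RatFunc.X - RatFunc.C a : RatFunc F) = algebraMap F[X] (RatFunc F) (X - C a) := by
      simp
    have h1 := RatFunc.eval_mul (RingHom.id F) a
      (show Polynomial.eval₂ (RingHom.id F) a (RatFunc.X - RatFunc.C a : RatFunc F).denom ≠ 0 by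
        rw [hX, RatFunc.denom_algebraMap]; simp) hmem
    rw [mul_inv_cancel₀ hne, RatFunc.eval_one, hX, RatFunc.eval_algebraMap] at h1
    simp at h1
  exists_zpow f hf := by
    obtain ⟨n, hn, hn'⟩ := f.num.exists_eq_pow_rootMultiplicity_mul_and_not_dvd
      (RatFunc.num_ne_zero hf) a
    obtain ⟨d, hd, hd'⟩ := f.denom.exists_eq_pow_rootMultiplicity_mul_and_not_dvd
      (RatFunc.denom_ne_zero f) a
    rw [Polynomial.dvd_iff_isRoot] at hn' hd'
    have hne := ratFunc_X_sub_C_ne_zero a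
    refine ⟨(f.num.rootMultiplicity a : ℤ) - f.denom.rootMultiplicity a,
      algebraMap F[X] (RatFunc F) n / algebraMap F[X] (RatFunc F) d, div_mem_localSubring _ hd',
      ?_, ?_⟩
    · rw [inv_div]; exact div_mem_localSubring _ hn'
    · conv_lhs => rw [← RatFunc.num_div_denom f, hn, hd]
      rw [zpow_sub₀ hne, zpow_natCast, zpow_natCast]
      simp only [map_mul, map_pow, map_sub, RatFunc.algebraMap_X, RatFunc.algebraMap_C]
      rw [mul_div_mul_comm]

theorem evalAt_map_subtype {p m : ℕ} (a : F) (M : Matrix (Fin p) (Fin m) (localSubring a)) :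
    evalAt a (M.map (localSubring a).subtype) = M.map (localEval a) := rfl

theorem isRegularAt_iff {m : ℕ} {a : F} {R : Matrix (Fin m) (Fin m) (RatFunc F)} :
    IsRegularAt a R ↔ ∃ R', IsIntegralInverse (localSubring a) R R' := by
  constructor
  · rintro ⟨h1, h2⟩
    have hR : IntegralMatrix (localSubring a) R := h1
    obtain ⟨M, rfl⟩ := hR.exists_map_subtype
    refine exists_integralInverse_of_isUnit_det ?_
    rw [evalAt_map_subtype] at h2
    have h3 : (M.map (localEval a)).det = localEval a M.det := ((localEval a).map_det M).symm
    rw [h3] at h2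
    have hne : (M.det : RatFunc F) ≠ 0 := by
      intro h0
      apply h2
      rw [show M.det = 0 from Subtype.ext h0, map_zero]
    exact IsUnit.of_mul_eq_one ⟨_, inv_mem_localSubring h2⟩
      (Subtype.ext (mul_inv_cancel₀ hne))
  · rintro ⟨R', hR⟩
    refine ⟨hR.integral, ?_⟩
    obtain ⟨M, rfl⟩ := hR.integral.exists_map_subtype
    obtain ⟨M', rfl⟩ := hR.integral_inv.exists_map_subtype
    have h1 : M * M' = 1 := by
      have := hR.mul_inv
      rw [← Matrix.map_mul, ← Matrix.map_one (localSubring a).subtype (map_zero _) (map_one _)]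
        at this
      exact Matrix.map_injective Subtype.val_injective this
    rw [evalAt_map_subtype]
    have h2 : M.map (localEval a) * M'.map (localEval a) = 1 := by
      rw [← Matrix.map_mul, h1]
      exact Matrix.map_one _ (map_zero _) (map_one _)
    exact (Matrix.isUnit_det_of_right_inverse h2).ne_zero

theorem equivalentAt_iff {p m : ℕ} {a : F} {G H : Matrix (Fin p) (Fin m) (RatFunc F)} :
    EquivalentAt a G H ↔ LocalEquiv (localSubring a) G H := by
  constructor
  · rintro ⟨R₁, R₂, h1, h2, h⟩
    obtain ⟨R₁', h1⟩ := isRegularAt_iff.1 h1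
    obtain ⟨R₂', h2⟩ := isRegularAt_iff.1 h2
    exact ⟨_, _, _, _, h1, h2, h⟩
  · rintro ⟨U, U', V, V', hU, hV, h⟩
    exact ⟨U, V, isRegularAt_iff.2 ⟨_, hU⟩, isRegularAt_iff.2 ⟨_, hV⟩, h⟩

theorem isInvariantOrdersAt_iff {p m : ℕ} {a : F} {G : Matrix (Fin p) (Fin m) (RatFunc F)}
    {ν : List ℤ} : IsInvariantOrdersAt a G ν ↔
      ν.Pairwise (· ≤ ·) ∧ HasOrders (localSubring a) (RatFunc.X - RatFunc.C a) G ν := by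
  have hp : G.rank ≤ p := by simpa using G.rank_le_card_height
  have hm : G.rank ≤ m := by simpa using G.rank_le_card_width
  rw [IsInvariantOrdersAt, equivalentAt_iff]
  constructor
  · rintro ⟨h1, h2, h3⟩
    exact ⟨h2, (hasOrders_diagPowers (h1.trans_le hp) (h1.trans_le hm)).of_localEquiv h3⟩
  · rintro ⟨h1, h2⟩
    have hcard : ν.length = G.rank := by
      simpa using h2.card_eq_rank (isUniformizer_localSubring a)
    exact ⟨hcard, h1,
      h2.localEquiv (hasOrders_diagPowers (hcard.trans_le hp) (hcard.trans_le hm))⟩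

theorem list_eq_of_pairwise {l l' : List ℤ} (hl : l.Pairwise (· ≤ ·)) (hl' : l'.Pairwise (· ≤ ·))
    (h : (l : Multiset ℤ) = l') : l = l' :=
  (Multiset.coe_eq_coe.1 h).eq_of_pairwise' hl hl'

/-- Partial multiplicities are the sorted list of the nonzero orders. -/
theorem isPartialMultiplicitiesAt_iff {p m : ℕ} {a : F} {M : Matrix (Fin p) (Fin m) F[X]}
    {s : Multiset ℤ} (hs : HasOrders (localSubring a) (RatFunc.X - RatFunc.C a) (toRat M) s)
    {e : List ℤ} : IsPartialMultiplicitiesAt a M e ↔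
      e.Pairwise (· ≤ ·) ∧ (e : Multiset ℤ) = s.filter (fun k => k ≠ 0) := by
  simp only [IsPartialMultiplicitiesAt, isInvariantOrdersAt_iff]
  constructor
  · rintro ⟨ν, ⟨h1, h2⟩, rfl⟩
    refine ⟨h1.filter _, ?_⟩
    rw [hs.unique (isUniformizer_localSubring a) h2, Multiset.filter_coe]
  · rintro ⟨h1, h2⟩
    refine ⟨s.sort, ⟨Multiset.pairwise_sort _ _, by rwa [Multiset.sort_eq]⟩, ?_⟩
    refine list_eq_of_pairwise h1 ((Multiset.pairwise_sort _ _).filter _) ?_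
    rw [h2, ← Multiset.filter_coe, Multiset.sort_eq]

theorem existsUnique_isPartialMultiplicitiesAt {p m : ℕ} (a : F)
    (M : Matrix (Fin p) (Fin m) F[X]) : ∃! e : List ℤ, IsPartialMultiplicitiesAt a M e := by
  obtain ⟨s, hs⟩ := HasOrders.exists_hasOrders (isUniformizer_localSubring a) (toRat M)
  simp only [isPartialMultiplicitiesAt_iff hs]
  refine ⟨(s.filter fun k => k ≠ 0).sort, ⟨Multiset.pairwise_sort _ _, Multiset.sort_eq _ _⟩, ?_⟩
  rintro e ⟨h1, h2⟩
  exact list_eq_of_pairwise h1 (Multiset.pairwise_sort _ _) (by rw [h2, Multiset.sort_eq])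

end Localization

/-! ### The point at infinity -/

section RankMap

theorem rank_map_le {K L : Type*} [Field K] [Field L] (f : K →+* L) {ι κ : Type*} [Fintype ι]
    [Fintype κ] (M : Matrix ι κ K) : (M.map f).rank ≤ M.rank := by
  classical
  -- factor `M` through its column space
  set b := Module.finBasis K (LinearMap.range M.mulVecLin) with hb
  set B : Matrix ι (Fin (Module.finrank K (LinearMap.range M.mulVecLin))) K :=
    Matrix.of fun i k => (b k : ι → K) i with hB
  set C : Matrix (Fin (Module.finrank K (LinearMap.range M.mulVecLin))) κ K :=
    Matrix.of fun k j => b.repr ⟨M.mulVecLin (Pi.single j 1), LinearMap.mem_range_self _ _⟩ k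
    with hC
  have hM : M = B * C := by
    ext i j
    have h := congrArg (fun v : LinearMap.range M.mulVecLin => (v : ι → K) i)
      (b.sum_repr ⟨M.mulVecLin (Pi.single j 1), LinearMap.mem_range_self _ _⟩)
    simp only [Submodule.coe_sum, Submodule.coe_smul, Finset.sum_apply, Pi.smul_apply,
      smul_eq_mul, mulVecLin_apply, mulVec_single_one, col_apply] at h
    rw [← h, Matrix.mul_apply]
    exact Finset.sum_congr rfl fun k _ => by simp [hB, hC, mul_comm]
  calc (M.map f).rank = (B.map f * C.map f).rank := by rw [← Matrix.map_mul, ← hM]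
    _ ≤ (B.map f).rank := rank_mul_le_left _ _
    _ ≤ _ := by simpa [Matrix.rank] using (B.map f).rank_le_card_width

end RankMap

section Infinity

variable {F : Type*} [Field F]

theorem eval₂_C_X_inv_ne_zero {q : F[X]} (hq : q ≠ 0) :
    q.eval₂ (RatFunc.C : F →+* RatFunc F) (RatFunc.X)⁻¹ ≠ 0 := by
  have hX : (RatFunc.X : RatFunc F) ≠ 0 := RatFunc.X_ne_zero
  let _ : Invertible (RatFunc.X⁻¹ : RatFunc F) := invertibleOfNonzero (inv_ne_zero hX)
  have key := Polynomial.eval₂_reflect_mul_pow (RatFunc.C : F →+* RatFunc F)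
    (RatFunc.X⁻¹ : RatFunc F) q.natDegree q le_rfl
  have hinv : (⅟(RatFunc.X⁻¹ : RatFunc F)) = RatFunc.X := by simp
  have h2 : ∀ q : F[X], eval₂ (RatFunc.C : F →+* RatFunc F) RatFunc.X q
      = algebraMap F[X] (RatFunc F) q := by
    intro q
    rw [← RatFunc.algebraMap_X, ← RatFunc.algebraMap_comp_C, ← Polynomial.hom_eval₂,
      Polynomial.eval₂_C_X]
  rw [hinv, h2] at key
  rw [← key]
  refine mul_ne_zero ?_ (pow_ne_zero _ (inv_ne_zero hX))
  rw [map_ne_zero_iff _ (RatFunc.algebraMap_injective F)]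
  simpa using hq

/-- The substitution `f ↦ f(1/X)` as a ring homomorphism; it is well behaved because no nonzero
polynomial vanishes at `1/X`. -/
def substInvHom : RatFunc F →+* RatFunc F where
  toFun := substInv
  map_one' := RatFunc.eval_one _ _
  map_zero' := RatFunc.eval_zero _ _
  map_mul' x y := RatFunc.eval_mul _ _ (eval₂_C_X_inv_ne_zero x.denom_ne_zero)
    (eval₂_C_X_inv_ne_zero y.denom_ne_zero)
  map_add' x y := RatFunc.eval_add _ _ (eval₂_C_X_inv_ne_zero x.denom_ne_zero)
    (eval₂_C_X_inv_ne_zero y.denom_ne_zero)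

theorem substInvHom_X : substInvHom (RatFunc.X : RatFunc F) = RatFunc.X⁻¹ :=
  RatFunc.eval_X _ _

theorem substInvHom_C (c : F) : substInvHom (RatFunc.C c) = RatFunc.C c :=
  RatFunc.eval_C _ _

theorem substInvHom_comp_self : substInvHom.comp substInvHom = RingHom.id (RatFunc F) := by
  refine IsLocalization.ringHom_ext (nonZeroDivisors F[X]) (Polynomial.ringHom_ext ?_ ?_)
  · intro c
    simp [substInvHom_C]
  · simp [substInvHom_X]

theorem map_substInvHom_map {p m : ℕ} (G : Matrix (Fin p) (Fin m) (RatFunc F)) :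
    (G.map substInvHom).map substInvHom = G := by
  ext i j : 2
  exact DFunLike.congr_fun substInvHom_comp_self (G i j)

theorem rank_map_substInvHom {p m : ℕ} (G : Matrix (Fin p) (Fin m) (RatFunc F)) :
    (G.map substInvHom).rank = G.rank := by
  refine le_antisymm (rank_map_le _ _) ?_
  conv_lhs => rw [← map_substInvHom_map G]
  exact rank_map_le _ _

theorem equivalentAtInfinity_iff {p m : ℕ} {G H : Matrix (Fin p) (Fin m) (RatFunc F)} :
    EquivalentAtInfinity G H ↔ EquivalentAt 0 (G.map substInvHom) (H.map substInvHom) := by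
  constructor
  · rintro ⟨R₁, R₂, h1, h2, rfl⟩
    exact ⟨_, _, h1, h2, by rw [Matrix.map_mul, Matrix.map_mul]; rfl⟩
  · rintro ⟨R₁, R₂, h1, h2, h⟩
    refine ⟨R₁.map substInvHom, R₂.map substInvHom, ?_, ?_, ?_⟩
    · rw [← map_substInvHom_map R₁] at h1; exact h1
    · rw [← map_substInvHom_map R₂] at h2; exact h2
    · rw [← map_substInvHom_map H, ← h, Matrix.map_mul, Matrix.map_mul, map_substInvHom_map]

theorem map_diagPowers {p m : ℕ} (ν : List ℤ) :
    (diagPowers p m (1 / RatFunc.X : RatFunc F) ν).map substInvHom =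
      diagPowers p m (RatFunc.X - RatFunc.C 0) ν := by
  ext i j : 2
  rw [Matrix.map_apply, diagPowers_apply, diagPowers_apply]
  split_ifs
  · rw [map_zpow₀, one_div, map_inv₀, substInvHom_X, inv_inv, map_zero, sub_zero]
  · exact map_zero _

theorem isInvariantOrdersAtInfinity_iff {p m : ℕ} {G : Matrix (Fin p) (Fin m) (RatFunc F)}
    {μ : List ℤ} :
    IsInvariantOrdersAtInfinity G μ ↔ IsInvariantOrdersAt 0 (G.map substInvHom) μ := by
  rw [IsInvariantOrdersAtInfinity, IsInvariantOrdersAt, rank_map_substInvHom,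
    equivalentAtInfinity_iff, map_diagPowers]

end Infinity

/-! ### Minimality and reversal -/

section Minimal

variable {F : Type*} [Field F] {σ κ : Type*} [Fintype σ] [Fintype κ] [DecidableEq σ]

theorem exists_mul_eq_one_of_rank {M : Matrix σ κ F} (h : M.rank = Fintype.card σ) :
    ∃ R : Matrix κ σ F, M * R = 1 := by
  refine mulVec_surjective_iff_exists_right_inverse.1 ?_
  have : LinearMap.range M.mulVecLin = ⊤ := by
    apply Submodule.eq_top_of_finrank_eq
    rw [Module.finrank_fintype_fun_eq_card]
    exact h
  exact LinearMap.range_eq_top.1 this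

/-- A right inverse at `0` lifts to a right inverse over the local ring: a constant lift `R₀` gives
`M R₀ = 1 - X Q`, which is invertible. -/
theorem exists_integral_mul_eq_one (M : Matrix σ κ F[X])
    (h : (M.map (Polynomial.eval 0)).rank = Fintype.card σ) :
    ∃ R : Matrix κ σ (RatFunc F), IntegralMatrix (localSubring (0 : F)) R ∧
      M.map (algebraMap F[X] (RatFunc F)) * R = 1 := by
  obtain ⟨R₀, hR₀⟩ := exists_mul_eq_one_of_rank h
  set N : Matrix σ σ F[X] := M * R₀.map C with hN
  have hN0 : N.map (Polynomial.eval 0) = 1 := by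
    have hR : (R₀.map C).map (Polynomial.evalRingHom 0) = R₀ := by
      ext i j
      simp
    have : N.map (Polynomial.evalRingHom 0) = M.map (Polynomial.evalRingHom 0) * R₀ := by
      rw [hN, Matrix.map_mul, hR]
    exact this.trans hR₀
  have hdiv : ∀ i j, ∃ q : F[X], (1 - N) i j = X * q := by
    intro i j
    rw [← dvd_def, X_dvd_iff, coeff_zero_eq_eval_zero]
    have := congrFun (congrFun hN0 i) j
    rw [Matrix.map_apply] at this
    rw [Matrix.sub_apply, eval_sub, this]
    by_cases hij : i = j
    · subst hij; simp
    · simp [hij]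
  choose Q hQ using hdiv
  have hNQ : N.map (algebraMap F[X] (RatFunc F)) =
      1 - (RatFunc.X - RatFunc.C 0 : RatFunc F) •
        (Matrix.of Q).map (algebraMap F[X] (RatFunc F)) := by
    have h1 : N = 1 - (X : F[X]) • Matrix.of Q := by
      ext i j : 2
      have := hQ i j
      rw [Matrix.sub_apply] at this
      simp [← this]
    conv_lhs => rw [h1]
    ext i j : 2
    by_cases hij : i = j <;> simp [hij]
  obtain ⟨V, hV⟩ := (isUniformizer_localSubring (0 : F)).exists_integralInverse_one_sub
    (M := (Matrix.of Q).map (algebraMap F[X] (RatFunc F)))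
    (fun _ _ => algebraMap_mem_localSubring _ _)
  refine ⟨(R₀.map C).map (algebraMap F[X] (RatFunc F)) * V, ?_, ?_⟩
  · exact IntegralMatrix.mul (fun _ _ => algebraMap_mem_localSubring _ _) hV.integral_inv
  · rw [← Matrix.mul_assoc, ← Matrix.map_mul, ← hN, hNQ, hV.mul_inv]

end Minimal

section System

variable {F : Type*} [Field F]

theorem integralMatrix_toRat {p m : ℕ} (a : F) (M : Matrix (Fin p) (Fin m) F[X]) :
    IntegralMatrix (localSubring a) (toRat M) := fun _ _ => algebraMap_mem_localSubring _ _

theorem toRat_systemMatrix {n p m : ℕ} (A : Matrix (Fin n) (Fin n) F[X])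
    (B : Matrix (Fin n) (Fin m) F[X]) (C : Matrix (Fin p) (Fin n) F[X])
    (D : Matrix (Fin p) (Fin m) F[X]) :
    toRat (systemMatrix A B C D) =
      (Matrix.fromBlocks (toRat A) (toRat B) (-toRat C) (toRat D)).submatrix
        finSumFinEquiv.symm finSumFinEquiv.symm := by
  rw [toRat, systemMatrix, Matrix.reindex_apply, ← Matrix.submatrix_map, Matrix.fromBlocks_map]
  congr 2
  ext i j : 2
  simp [toRat]

/-- Minimality at `0` as a pair of Bézout identities over the local ring at `0`. -/
theorem exists_bezout_of_isMinimalAt {n p m : ℕ} {A : Matrix (Fin n) (Fin n) F[X]}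
    {B : Matrix (Fin n) (Fin m) F[X]} {C : Matrix (Fin p) (Fin n) F[X]}
    (h : IsMinimalAt 0 A B C) :
    ∃ (X X' : Matrix (Fin n) (Fin n) (RatFunc F)) (Y : Matrix (Fin n) (Fin p) (RatFunc F))
      (Y' : Matrix (Fin m) (Fin n) (RatFunc F)),
      IntegralMatrix (localSubring (0 : F)) X ∧ IntegralMatrix (localSubring (0 : F)) X' ∧
      IntegralMatrix (localSubring (0 : F)) Y ∧ IntegralMatrix (localSubring (0 : F)) Y' ∧
      X * toRat A + Y * toRat C = 1 ∧ toRat A * X' + toRat B * Y' = 1 := by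
  obtain ⟨h1, h2⟩ := h
  obtain ⟨L, hL, hL1⟩ := exists_integral_mul_eq_one (Matrix.fromRows A C)ᵀ (by
    rw [Matrix.transpose_map, rank_transpose, Matrix.fromRows_map, h1, Fintype.card_fin])
  obtain ⟨R, hR, hR1⟩ := exists_integral_mul_eq_one (Matrix.fromCols A B) (by
    rw [Matrix.fromCols_map, h2, Fintype.card_fin])
  refine ⟨Lᵀ.toCols₁, R.toRows₁, Lᵀ.toCols₂, R.toRows₂, fun _ _ => hL _ _, fun _ _ => hR _ _,
    fun _ _ => hL _ _, fun _ _ => hR _ _, ?_, ?_⟩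
  · have h3 := congrArg Matrix.transpose hL1
    rw [Matrix.transpose_mul, Matrix.transpose_one, ← Matrix.transpose_map, transpose_transpose,
      Matrix.fromRows_map, ← fromCols_toCols Lᵀ, fromCols_mul_fromRows] at h3
    exact h3
  · rw [Matrix.fromCols_map, ← fromRows_toRows R, fromCols_mul_fromRows] at hR1
    exact hR1

end System

section Reversal

variable {F : Type*} [Field F]

theorem natDegree_le_matrixDegree {p m : ℕ} (M : Matrix (Fin p) (Fin m) F[X]) (i : Fin p)
    (j : Fin m) : (M i j).natDegree ≤ matrixDegree M :=
  (Finset.le_sup (f := fun j => (M i j).natDegree) (Finset.mem_univ j)).trans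
    (Finset.le_sup (f := fun i => Finset.univ.sup fun j => (M i j).natDegree) (Finset.mem_univ i))

theorem matrixDegree_le {p m d : ℕ} {M : Matrix (Fin p) (Fin m) F[X]}
    (h : ∀ i j, (M i j).natDegree ≤ d) : matrixDegree M ≤ d :=
  Finset.sup_le fun i _ => Finset.sup_le fun j _ => h i j

variable {n p m : ℕ} {A : Matrix (Fin n) (Fin n) F[X]} {B : Matrix (Fin n) (Fin m) F[X]}
  {C : Matrix (Fin p) (Fin n) F[X]} {D : Matrix (Fin p) (Fin m) F[X]}

theorem matrixDegree_blocks_le :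
    matrixDegree A ≤ matrixDegree (systemMatrix A B C D) ∧
    matrixDegree B ≤ matrixDegree (systemMatrix A B C D) ∧
    matrixDegree C ≤ matrixDegree (systemMatrix A B C D) ∧
    matrixDegree D ≤ matrixDegree (systemMatrix A B C D) := by
  have key := fun i j => natDegree_le_matrixDegree (systemMatrix A B C D)
    (finSumFinEquiv i) (finSumFinEquiv j)
  refine ⟨matrixDegree_le fun i j => ?_, matrixDegree_le fun i j => ?_,
    matrixDegree_le fun i j => ?_, matrixDegree_le fun i j => ?_⟩
  · simpa [systemMatrix] using key (Sum.inl i) (Sum.inl j)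
  · simpa [systemMatrix] using key (Sum.inl i) (Sum.inr j)
  · simpa [systemMatrix] using key (Sum.inr i) (Sum.inl j)
  · simpa [systemMatrix] using key (Sum.inr i) (Sum.inr j)

theorem toRat_polyRev_eq_smul {d : ℕ} {M : Matrix (Fin p) (Fin m) F[X]} (h : matrixDegree M ≤ d) :
    toRat (polyRev d M) = (RatFunc.X : RatFunc F) ^ (d : ℤ) • (toRat M).map substInvHom :=
  toRat_polyRev d M h

theorem toRat_mul_inv (hA : A.det ≠ 0) : toRat A * (toRat A)⁻¹ = 1 := by
  apply Matrix.mul_nonsing_inv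
  have : (toRat A).det = algebraMap F[X] (RatFunc F) A.det :=
    ((algebraMap F[X] (RatFunc F)).map_det A).symm
  rw [this, isUnit_iff_ne_zero]
  exact (map_ne_zero_iff _ (RatFunc.algebraMap_injective F)).2 hA

/-- The transfer function of the reversed system matrix is the `d`-reversal of `G`. -/
theorem exists_inverse_polyRev {G : Matrix (Fin p) (Fin m) (RatFunc F)} {d : ℕ}
    (hG : IsSystemMatrixOf A B C D G) (hd : matrixDegree (systemMatrix A B C D) = d) :
    ∃ Ai, toRat (polyRev d A) * Ai = 1 ∧
      toRat (polyRev d D) + toRat (polyRev d C) * Ai * toRat (polyRev d B) =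
        (RatFunc.X : RatFunc F) ^ (d : ℤ) • G.map substInvHom := by
  obtain ⟨hA, hB, hC, hD⟩ := matrixDegree_blocks_le (A := A) (B := B) (C := C) (D := D)
  rw [hd] at hA hB hC hD
  have hx : (RatFunc.X : RatFunc F) ^ (d : ℤ) ≠ 0 := zpow_ne_zero _ RatFunc.X_ne_zero
  set x : RatFunc F := RatFunc.X ^ (d : ℤ) with hxdef
  refine ⟨x⁻¹ • ((toRat A)⁻¹).map substInvHom, ?_, ?_⟩
  · rw [toRat_polyRev_eq_smul hA, Matrix.smul_mul, Matrix.mul_smul, smul_smul, mul_inv_cancel₀ hx,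
      one_smul, ← Matrix.map_mul, toRat_mul_inv hG.1]
    exact Matrix.map_one _ (map_zero _) (map_one _)
  · rw [toRat_polyRev_eq_smul hB, toRat_polyRev_eq_smul hC, toRat_polyRev_eq_smul hD, hG.2,
      Matrix.map_add _ (map_add _), Matrix.map_mul, Matrix.map_mul]
    simp only [Matrix.smul_mul, Matrix.mul_smul, smul_smul, smul_add]
    rw [← hxdef]
    congr 2
    field_simp

end Reversal

/-! ### Sorted lists of orders -/

section Lists

theorem pairwise_orders {e e' : List ℤ} (c : ℕ) (d : ℤ) (he : e.Pairwise (· ≤ ·))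
    (he' : e'.Pairwise (· ≤ ·)) (hpos : ∀ k ∈ e, 0 ≤ k) (hpos' : ∀ k ∈ e', 0 ≤ k) :
    (((e.reverse.map fun k => -k) ++ List.replicate c 0 ++ e').map fun k => k - d).Pairwise
      (· ≤ ·) := by
  rw [List.pairwise_map]
  simp only [sub_le_sub_iff_right]
  rw [List.pairwise_append, List.pairwise_append, List.pairwise_map, List.pairwise_reverse]
  refine ⟨⟨he.imp fun h => neg_le_neg h, List.pairwise_replicate.2 (Or.inr le_rfl), ?_⟩, he', ?_⟩
  · intro a ha b hb
    obtain ⟨k, hk, rfl⟩ := List.mem_map.1 ha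
    have := hpos k (List.mem_reverse.1 hk)
    rw [(List.mem_replicate.1 hb).2]
    omega
  · intro a ha b hb
    have hb' := hpos' b hb
    rcases List.mem_append.1 ha with ha | ha
    · obtain ⟨k, hk, rfl⟩ := List.mem_map.1 ha
      have := hpos k (List.mem_reverse.1 hk)
      omega
    · rw [(List.mem_replicate.1 ha).2]
      exact hb'

theorem replicate_add_filter_ne_zero (w : Multiset ℤ) :
    Multiset.replicate (w.count 0) 0 + w.filter (fun k => k ≠ 0) = w := by
  rw [← Multiset.filter_eq']
  exact Multiset.filter_add_not _ w

theorem filter_replicate_zero_add (a : ℕ) (w : Multiset ℤ) :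
    (Multiset.replicate a 0 + w).filter (fun k => k ≠ 0) = w.filter (fun k => k ≠ 0) := by
  rw [Multiset.filter_add, Multiset.filter_eq_nil.2, zero_add]
  intro k hk
  simp [Multiset.eq_of_mem_replicate hk]

end Lists

end RationalMatrix

end

open RationalMatrix in
theorem theorem3p8 {F : Type*} [Field F] [IsAlgClosed F] (n p m r d : ℕ)
    (G : Matrix (Fin p) (Fin m) (RatFunc F)) (hr : G.rank = r)
    (A : Matrix (Fin n) (Fin n) (Polynomial F)) (B : Matrix (Fin n) (Fin m) (Polynomial F))
    (C : Matrix (Fin p) (Fin n) (Polynomial F)) (D : Matrix (Fin p) (Fin m) (Polynomial F))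
    (hG : IsSystemMatrixOf A B C D G)
    (hd : matrixDegree (systemMatrix A B C D) = d)
    (hmin : IsMinimalAtInfinity A B C D) :
    -- the partial multiplicities at `0` of `rev_d A` and of `rev P` are well defined
    (∃! e : List ℤ, IsPartialMultiplicitiesAt 0 (polyRev d A) e) ∧
    (∃! e' : List ℤ, IsPartialMultiplicitiesAt 0 (polyRev d (systemMatrix A B C D)) e') ∧
    -- and they give the invariant orders of `G` at infinity
    ∀ e e' : List ℤ,
      IsPartialMultiplicitiesAt 0 (polyRev d A) e →
      IsPartialMultiplicitiesAt 0 (polyRev d (systemMatrix A B C D)) e' →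
      e.length + e'.length ≤ r ∧
      ∀ q : List ℤ, IsInvariantOrdersAtInfinity G q ↔
        q = ((e.reverse.map fun k => -k) ++ List.replicate (r - e.length - e'.length) 0 ++ e').map
          fun k => k - (d : ℤ) := by
  refine ⟨existsUnique_isPartialMultiplicitiesAt _ _,
    existsUnique_isPartialMultiplicitiesAt _ _, ?_⟩
  have hO := isUniformizer_localSubring (0 : F)
  rw [IsMinimalAtInfinity, hd] at hmin
  obtain ⟨X, X', Y, Y', hX, hX', hY, hY', hXY, hXY'⟩ := exists_bezout_of_isMinimalAt hmin
  obtain ⟨Ai, hAi, hGrev⟩ := exists_inverse_polyRev hG hd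
  obtain ⟨w, ε, a, b, hw, hε, hAo, hPo, hGo⟩ := exists_orders_system hO
    (integralMatrix_toRat 0 (polyRev d A)) (integralMatrix_toRat 0 (polyRev d B))
    (integralMatrix_toRat 0 (polyRev d C)) (integralMatrix_toRat 0 (polyRev d D))
    hX hX' hY hY' hAi hXY hXY'
  have hPo' := hPo.of_localEquiv (LocalEquiv.submatrix _ finSumFinEquiv.symm
    finSumFinEquiv.symm).symm
  rw [← toRat_systemMatrix, ← polyRev_systemMatrix] at hPo'
  -- the factor `X ^ d` of the reversed transfer function shifts the orders by `d`
  have hG' : HasOrders (localSubring (0 : F)) (RatFunc.X - RatFunc.C 0)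
      (G.map substInvHom) ((ε.map (fun k => -k) + w).map fun k => k - (d : ℤ)) := by
    have h1 := hGo.smul_zpow hO (-d)
    have hx : (RatFunc.X : RatFunc F) ^ (d : ℤ) ≠ 0 := zpow_ne_zero _ RatFunc.X_ne_zero
    rw [hGrev, map_zero, sub_zero, smul_smul, zpow_neg, inv_mul_cancel₀ hx, one_smul] at h1
    simpa [sub_eq_add_neg] using h1
  have hcard : Multiset.card ε + Multiset.card w = r := by
    have := hG'.card_eq_rank hO
    rw [rank_map_substInvHom, hr] at this
    simpa using this
  intro e e' he he'
  obtain ⟨he1, he2⟩ := (isPartialMultiplicitiesAt_iff hAo).1 he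
  obtain ⟨he'1, he'2⟩ := (isPartialMultiplicitiesAt_iff hPo').1 he'
  rw [filter_replicate_zero_add] at he2 he'2
  rw [Multiset.filter_eq_self.2 fun k hk => (hε k hk).ne'] at he2
  have hlen : Multiset.card ε = e.length := by rw [← he2, Multiset.coe_card]
  have hw' := replicate_add_filter_ne_zero w
  rw [← he'2] at hw'
  have hlen' : Multiset.card w = w.count 0 + e'.length := by
    conv_lhs => rw [← hw']
    simp
  have hc : r - e.length - e'.length = w.count 0 := by omega
  refine ⟨by omega, fun q => ?_⟩
  have hsorted := pairwise_orders (w.count 0) d he1 he'1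
    (fun k hk => (hε k (by rw [← he2]; exact hk)).le)
    (fun k hk => hw k (by rw [← hw']; exact Multiset.mem_add.2 (Or.inr hk)))
  have hcoe : (((((e.reverse.map fun k => -k) ++ List.replicate (w.count 0) 0 ++ e').map
      fun k => k - (d : ℤ)) : List ℤ) : Multiset ℤ) =
      (ε.map (fun k => -k) + w).map fun k => k - (d : ℤ) := by
    rw [← Multiset.map_coe, ← Multiset.coe_add, ← Multiset.coe_add, ← Multiset.map_coe,
      Multiset.coe_reverse, Multiset.coe_replicate, he2, add_assoc, hw']
  rw [isInvariantOrdersAtInfinity_iff, isInvariantOrdersAt_iff, hc]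
  constructor
  · rintro ⟨h1, h2⟩
    exact list_eq_of_pairwise h1 hsorted ((h2.unique hO hG').trans hcoe.symm)
  · rintro rfl
    exact ⟨hsorted, by rwa [hcoe]⟩
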